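/- Theorem A. An algorithm is a deterministic multi-tape Turing machine. A time-complexity class $\mathcal C$ is given by a collection of proper (i.e. non-decreasing and computable in unary in time $O(n+f(n))$) time bounds $f:\mathbb N\to\mathbb N$ with $f(n)\ge n$ such that, for every $f$ in the collection and every integer $C\ge 1$, the function $n\mapsto C f(Cn+C)+C$ is also in the collection; a language belongs to $\mathcal C$ if it is decided by an algorithm in time $f(n)$ for some bound $f$ of the collection. $\mathrm{SubExp}$ is the class of languages decidable in time $f(n)$ for some $f$ with $\lim_{n\to\infty} f(n)/r^n=0$ for all $r>1$. For a group $G$ and a finite set $A$ of letters with a map $\pi: A\to G$ whose image generates $G$, let $WP(G,A)\subseteq (A\cup A^{-1})^*$ be the set of words over $A$ and its formal inverses that represent $1\in G$; the word problem of a group is in a class if $WP(G,A)$ is in it for some such $A$. Let $G$ be a finitely presented group whose word problem is in $\mathrm{SubExp}$. Suppose that $G$ has a subgroup of finite index which has a non-amenable quotient group $G_1$ whose word problem is in a time-complexity class $\mathcal C$ with $\mathcal C\subseteq\mathrm{SubExp}$. Then, for every finite generating set $A$ of $G$, $WP(G,A)$ is solvable with average-case complexity in $\mathcal C$ uniformly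 over all length-invariant discrete probability measures on $(A\cup A^{-1})^*$. That is, there are an algorithm $M$ that decides $WP(G,A)$, halting on each word $w$ after $T(w)<\infty$ steps, a positive non-decreasing time bound $f$ of $\mathcal C$, and a constant $0<C<\infty$ such that $$\sum_{w\in (A\cup A^{-1})^*}\frac{T(w)}{f(|w|)}\,\mu(w)\le C$$ for every probability measure $\mu:(A\cup A^{-1})^*\to[0,1]$ with $\mu(w)=\mu(w')$ whenever $|w|=|w'|$. -/

import Mathlib

open scoped ENNReal NNReal Topology

/-! ### Deterministic multi-tape Turing machines -/

/-- A deterministic multi-tape Turing machine with input alphabet `X`.  It has finitely many tapes,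
one of which is the input tape, a finite tape alphabet containing `X` and a blank symbol outside
`X`, and finitely many (non-halting) states.  In each step it looks at the current state and at
the symbols under all heads; it then passes to a new state or halts with answer `true` ("yes") or
`false` ("no"), and on every tape it overwrites the scanned symbol and moves the head by
`-1`, `0` or `1`. -/
structure TuringMachine (X : Type) where
  Tape : Type
  Symbol : Type
  State : Type
  finite_tape : Finite Tape
  finite_symbol : Finite Symbol
  finite_state : Finite State
  input : Tape
  blank : Symbol
  encode : X → Symbol
  encode_injective : Function.Injective encode
  encode_ne_blank : ∀ x, encode x ≠ blank
  start : State
  transition : State → (Tape → Symbol) → (State ⊕ Bool) × (Tape → Symbol × SignType)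

namespace TuringMachine

variable {X : Type}

/-- A configuration: the state (`Sum.inr b` means halted with answer `b`), the contents of the
two-way infinite tapes and the positions of the heads. -/
structure Config (M : TuringMachine X) where
  state : M.State ⊕ Bool
  content : M.Tape → ℤ → M.Symbol
  head : M.Tape → ℤ

/-- The initial configuration on `w`: the letters of `w` occupy the cells `0, …, |w| - 1` of the
input tape, all other cells of all tapes are blank, and all heads are at `0`. -/
noncomputable def init (M : TuringMachine X) (w : List X) : M.Config where
  state := Sum.inl M.start
  content := open Classical in fun τ i =>
    if h : τ = M.input ∧ 0 ≤ i ∧ i.toNat < w.length then M.encode (w[i.toNat]'h.2.2) else M.blank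
  head := fun _ => 0

/-- One step of the computation; halted configurations do not change. -/
def step (M : TuringMachine X) (c : M.Config) : M.Config :=
  match c.state with
  | Sum.inr _ => c
  | Sum.inl q =>
    let r := M.transition q fun τ => c.content τ (c.head τ)
    { state := r.1
      content := fun τ => Function.update (c.content τ) (c.head τ) (r.2 τ).1
      head := fun τ => c.head τ + ((r.2 τ).2 : ℤ) }

/-- The configuration after `t` steps on input `w`. -/
noncomputable def run (M : TuringMachine X) (w : List X) (t : ℕ) : M.Config :=
  M.step^[t] (M.init w)

/-- `M` decides the language `D`: on every input word it halts, with the correct answer. -/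
def Decides (M : TuringMachine X) (D : Language X) : Prop :=
  ∀ w : List X, ∃ (t : ℕ) (b : Bool), (M.run w t).state = Sum.inr b ∧ (b = true ↔ w ∈ D)

/-- The time `T(w)`: the number of steps after which `M` halts on `w` (it is only used for machines
that halt on every input). -/
noncomputable def time (M : TuringMachine X) (w : List X) : ℕ :=
  sInf {t : ℕ | ∃ b : Bool, (M.run w t).state = Sum.inr b}

/-- `M` decides `D` in time `f(n)`, where `n` is the length of the input. -/
def DecidesInTime (M : TuringMachine X) (D : Language X) (f : ℕ → ℕ) : Prop :=
  M.Decides D ∧ ∀ w : List X, M.time w ≤ f w.length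

end TuringMachine

/-! ### Complexity classes -/

/-- A class of languages over arbitrary finite alphabets. -/
abbrev LanguageClass : Type 1 := ∀ X : Type, Set (Language X)

/-- `f` is subexponential: `f(n) / r ^ n → 0` for every `r > 1`. -/
def Subexponential (f : ℕ → ℕ) : Prop :=
  ∀ r : ℝ, 1 < r → Filter.Tendsto (fun n : ℕ => (f n : ℝ) / r ^ n) Filter.atTop (𝓝 0)

/-- The languages decidable in deterministic subexponential time. -/
def SubExp : LanguageClass := fun X =>
  {D | ∃ f : ℕ → ℕ, Subexponential f ∧ ∃ M : TuringMachine X, M.DecidesInTime D f}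

/-- `f` is a proper complexity function: it is non-decreasing, and some machine computes `f(n)` in
unary notation from any input of length `n` in time `O(n + f(n))`.  (This is used only for `f` with
`f(n) ≥ n`; then the usual requirement that the machine also uses space `O(f(n))` follows from the
time bound.) -/
def IsProperComplexityFunction (f : ℕ → ℕ) : Prop :=
  Monotone f ∧
    ∃ (M : TuringMachine Unit) (output : M.Tape) (one : M.Symbol) (K : ℕ), one ≠ M.blank ∧
      ∀ n : ℕ, ∃ t ≤ K * (n + f n + 1), ∃ b : Bool,
        (M.run (List.replicate n ()) t).state = Sum.inr b ∧
        ∀ i : ℤ, (0 ≤ i ∧ i < (f n : ℤ) →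
            (M.run (List.replicate n ()) t).content output i = one) ∧
          (¬ (0 ≤ i ∧ i < (f n : ℤ)) →
            (M.run (List.replicate n ()) t).content output i = M.blank)

/-- A deterministic time-complexity class, given by the collection of its time bounds: proper
complexity functions `f` with `f(n) ≥ n`, such that with `f` also all the functions
`n ↦ C f(C n + C) + C` (for integers `C ≥ 1`) belong to the collection. -/
structure TimeClass where
  bounds : Set (ℕ → ℕ)
  proper : ∀ f ∈ bounds, IsProperComplexityFunction f
  le_bound : ∀ f ∈ bounds, ∀ n, n ≤ f n
  rescale : ∀ f ∈ bounds, ∀ C : ℕ, 1 ≤ C → (fun n => C * f (C * n + C) + C) ∈ bounds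

/-- The languages decidable within one of the time bounds of the class `𝒞`. -/
def TimeClass.languages (𝒞 : TimeClass) : LanguageClass := fun X =>
  {D | ∃ f ∈ 𝒞.bounds, ∃ M : TuringMachine X, M.DecidesInTime D f}

/-! ### Average-case complexity -/

/-- A discrete probability measure on words is length-invariant if words of equal length have
equal measure. -/
def LengthInvariant {X : Type} (μ : PMF (List X)) : Prop :=
  ∀ w w' : List X, w.length = w'.length → μ w = μ w'

/-- `M` solves `D` with average-case time-complexity bounded by `f`, uniformly relative to the
family `R` of discrete probability measures. -/
def TuringMachine.SolvesOnAverage {X : Type} (M : TuringMachine X) (D : Language X) (f : ℕ → ℕ)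
    (R : Set (PMF (List X))) : Prop :=
  M.Decides D ∧ Monotone f ∧ (∀ n, 0 < f n) ∧
    ∃ C : ℝ≥0, ∀ μ ∈ R,
      ∑' w : List X, (M.time w : ℝ≥0∞) / (f w.length : ℝ≥0∞) * μ w ≤ (C : ℝ≥0∞)

/-- `D` is solvable with average-case time-complexity in `𝒞`, uniformly relative to `R`. -/
def SolvableOnAverageIn {X : Type} (D : Language X) (𝒞 : TimeClass)
    (R : Set (PMF (List X))) : Prop :=
  ∃ M : TuringMachine X, ∃ f ∈ 𝒞.bounds, M.SolvesOnAverage D f R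

/-! ### Groups -/

/-- The group element represented by a word in the letters `a = (a, true)` and
`a⁻¹ = (a, false)`, where the letter `a` represents `π a`. -/
def wordValue {G : Type*} [Group G] {A : Type} (π : A → G) (w : List (A × Bool)) : G :=
  (w.map fun x => if x.2 then π x.1 else (π x.1)⁻¹).prod

/-- The word problem: the language of all words over `A ∪ A⁻¹` that represent `1`. -/
def wordProblem {G : Type*} [Group G] {A : Type} (π : A → G) : Language (A × Bool) :=
  {w : List (A × Bool) | wordValue π w = 1}

/-- The word problem of `G`, with respect to some finite generating set, belongs to the given class
of languages. -/
def WordProblemIn (G : Type*) [Group G] (K : LanguageClass) : Prop :=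
  ∃ (B : Type) (_ : Finite B) (ρ : B → G),
    Subgroup.closure (Set.range ρ) = ⊤ ∧ wordProblem ρ ∈ K (B × Bool)

open Classical in
/-- Amenability of a discrete group (Følner condition): for every finite `S ⊆ G` and `ε > 0` there
is a non-empty finite `F ⊆ G` such that, for each `s ∈ S`, at most `ε |F|` of the edges
`x — x s` of the Cayley graph with `x ∈ F` leave `F`. -/
def IsAmenableGroup (G : Type*) [Group G] : Prop :=
  ∀ (S : Finset G) (ε : ℝ), 0 < ε →
    ∃ F : Finset G, F.Nonempty ∧
      ∀ s ∈ S, ((F.filter fun x => x * s ∉ F).card : ℝ) ≤ ε * (F.card : ℝ)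

/-! Let N be the kernel of φ, viewed as a subgroup of G (it need not be normal in G). A word that
represents 1 represents an element of N, and membership in N is cheap to test: a finite-state
transducer performs Schreier rewriting, which detects whether the word lies in H and turns it into a
word over generators of G₁ (`exists_transducer`); the fast algorithm for G₁ does the rest. Only
words that pass this test are handed to the slow, subexponential algorithm for G
(`TuringMachine.guard_halts`).

Words that pass are exponentially rare. The coset space G/N is a union of [G : H] copies of G₁
(`exists_bijective_smul_eq`), so non-amenability of G₁ gives an isoperimetric inequality for G
acting on G/N, first for suitable elements and then for any finite generating family
(`Isoperimetric.of_bijective`, `Isoperimetric.of_closure`). Cheeger's argument turns it into a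
spectral gap (`Isoperimetric.finsuppDot_walkOperator_le_of_nonneg`). Hence, of the kⁿ words of
length n, at most (rk)ⁿ with r < 1 fix the base coset, that is, lie in N (`exists_card_mem_ker_le`).

A length-invariant measure is uniform on each length, so the slow runs contribute at most rⁿ times a
subexponential function of an argument O(n), which is bounded (`Subexponential.exists_pow_mul_le`).
All other costs fit into a rescaled time bound for G₁. -/

/-! ### Finite-state transducers -/

/-- A deterministic finite-state transducer: it reads a word over `X`, writes a word over `Y`, and
accepts or rejects according to the state in which it ends. -/
structure Transducer (X Y : Type) where
  State : Type
  finite_state : Finite State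
  start : State
  next : State → X → State
  output : State → X → List Y
  bound : ℕ
  length_output_le : ∀ q x, (output q x).length ≤ bound
  accept : State → Prop

namespace Transducer

variable {X Y : Type} (T : Transducer X Y)

/-- The word written while reading `w` from the state `q`. -/
def translate : T.State → List X → List Y
  | _, [] => []
  | q, x :: w => T.output q x ++ translate (T.next q x) w

/-- The state reached by reading `w` from the state `q`. -/
def final (q : T.State) (w : List X) : T.State := w.foldl T.next q

theorem length_translate_le (w : List X) (q : T.State) :
    (T.translate q w).length ≤ T.bound * w.length := by
  induction w generalizing q with
  | nil => simp [translate]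
  | cons x w ih =>
    have := ih (T.next q x)
    have := T.length_output_le q x
    simp only [translate, List.length_append, List.length_cons]
    linarith

end Transducer

namespace TuringMachine

variable {X Y : Type}

/-! ### Halting times -/

theorem iterate_step_of_halted (M : TuringMachine X) {c : M.Config} {b : Bool}
    (h : c.state = Sum.inr b) (t : ℕ) : M.step^[t] c = c := by
  apply Function.iterate_fixed
  simp [step, h]

theorem time_le {M : TuringMachine X} {w : List X} {t : ℕ} {b : Bool}
    (h : (M.run w t).state = Sum.inr b) : M.time w ≤ t :=
  Nat.sInf_le ⟨b, h⟩

theorem Decides.run_time {M : TuringMachine X} {D : Language X} (h : M.Decides D) (w : List X) :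
    ∃ b : Bool, (M.run w (M.time w)).state = Sum.inr b ∧ (b = true ↔ w ∈ D) := by
  obtain ⟨t, b, hb, hD⟩ := h w
  obtain ⟨b', hb'⟩ : ∃ b, (M.run w (M.time w)).state = Sum.inr b :=
    Nat.sInf_mem (s := {t : ℕ | ∃ b : Bool, (M.run w t).state = Sum.inr b}) ⟨t, b, hb⟩
  obtain ⟨k, rfl⟩ := Nat.exists_eq_add_of_le' (time_le hb)
  have : M.run w (k + M.time w) = M.run w (M.time w) := by
    rw [run, Function.iterate_add_apply]
    exact iterate_step_of_halted M hb' k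
  rw [this, hb'] at hb
  obtain rfl := Sum.inr.inj hb
  exact ⟨b', hb', hD⟩

theorem exists_state_of_lt_time {M : TuringMachine X} {w : List X} {t : ℕ} (h : t < M.time w) :
    ∃ q, (M.run w t).state = Sum.inl q := by
  cases hs : (M.run w t).state with
  | inl q => exact ⟨q, rfl⟩
  | inr b => exact absurd (time_le hs) (not_le.2 h)

/-! ### Tape contents and head positions -/

/-- The content of a tape with the word `l` in the cells `0, …, |l| - 1`. -/
def tapeOf {S : Type} (blank : S) (e : Y → S) (l : List Y) (i : ℤ) : S :=
  if h : 0 ≤ i ∧ i.toNat < l.length then e (l[i.toNat]'h.2) else blank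

section tapeOf

variable {S : Type} (blank : S) (e : Y → S)

theorem tapeOf_length (l : List Y) : tapeOf blank e l l.length = blank := by
  simp [tapeOf]

theorem tapeOf_neg_one (l : List Y) : tapeOf blank e l (-1) = blank := by
  simp [tapeOf]

theorem tapeOf_append_cons (u : List Y) (x : Y) (v : List Y) :
    tapeOf blank e (u ++ x :: v) u.length = e x := by
  simp [tapeOf]

theorem tapeOf_natCast_ne {l : List Y} (he : ∀ y, e y ≠ blank) {n : ℕ} (hn : n < l.length) :
    tapeOf blank e l n ≠ blank := by
  simp [tapeOf, hn, he]

theorem update_tapeOf (l : List Y) (y : Y) :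
    Function.update (tapeOf blank e l) l.length (e y) = tapeOf blank e (l ++ [y]) := by
  ext i
  rcases eq_or_ne i l.length with rfl | hi
  · simp [tapeOf]
  · rw [Function.update_of_ne hi]
    by_cases h : 0 ≤ i ∧ i.toNat < l.length
    · have h' : 0 ≤ i ∧ i.toNat < (l ++ [y]).length := by simp; omega
      simp only [tapeOf, dif_pos h, dif_pos h', List.getElem_append_left h.2]
    · have h' : ¬ (0 ≤ i ∧ i.toNat < (l ++ [y]).length) := by simp; omega
      simp only [tapeOf, dif_neg h, dif_neg h']

end tapeOf

/-- The contents of the tapes and the positions of the heads. -/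
abbrev Tapes (M : TuringMachine X) : Type := (M.Tape → ℤ → M.Symbol) × (M.Tape → ℤ)

section Tapes

variable {M : TuringMachine X}

/-- The tapes of a configuration. -/
def Config.tapes (c : M.Config) : M.Tapes := (c.content, c.head)

theorem Config.eq_of {c c' : M.Config} (h₁ : c.state = c'.state) (h₂ : c.content = c'.content)
    (h₃ : c.head = c'.head) : c = c' := by
  cases c; cases c'; simp_all

/-- The symbols under the heads. -/
def scanned (p : M.Tapes) (τ : M.Tape) : M.Symbol := p.1 τ (p.2 τ)

/-- The effect on the tapes of overwriting the scanned symbols and moving the heads. -/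
def act (p : M.Tapes) (a : M.Tape → M.Symbol × SignType) : M.Tapes :=
  (fun τ => Function.update (p.1 τ) (p.2 τ) (a τ).1, fun τ => p.2 τ + ((a τ).2 : ℤ))

/-- The action that changes nothing if the scanned symbols are `r`. -/
def idle (r : M.Tape → M.Symbol) (τ : M.Tape) : M.Symbol × SignType := (r τ, 0)

open Classical in
/-- The action that writes `s` on the input tape and then moves its head by `d`. -/
noncomputable def onInput (s : M.Symbol) (d : SignType) (r : M.Tape → M.Symbol) (τ : M.Tape) :
    M.Symbol × SignType := if τ = M.input then (s, d) else (r τ, 0)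

open Classical in
/-- The input tape contains the word `w` and its head is at `i`; all other tapes are blank. -/
noncomputable def wordTapes (M : TuringMachine X) (w : List X) (i : ℤ) : M.Tapes :=
  (fun τ => if τ = M.input then tapeOf M.blank M.encode w else fun _ => M.blank,
    fun τ => if τ = M.input then i else 0)

theorem act_idle (p : M.Tapes) : act p (idle (scanned p)) = p := by
  simp [act, idle, scanned]

theorem scanned_wordTapes (w : List X) (i : ℤ) :
    scanned (M.wordTapes w i) M.input = tapeOf M.blank M.encode w i := by
  simp [scanned, wordTapes]

theorem act_onInput_wordTapes (w w' : List X) (i : ℤ) (s : M.Symbol) (d : SignType)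
    (h : Function.update (tapeOf M.blank M.encode w) i s = tapeOf M.blank M.encode w') :
    act (M.wordTapes w i) (onInput s d (scanned (M.wordTapes w i))) = M.wordTapes w' (i + d) := by
  refine Prod.ext ?_ ?_
  · funext τ
    by_cases hτ : τ = M.input
    · simp [act, onInput, wordTapes, hτ, h]
    · simp [act, onInput, wordTapes, hτ, scanned]
  · funext τ
    by_cases hτ : τ = M.input <;> simp [act, onInput, wordTapes, hτ]

theorem act_move_wordTapes (w : List X) (i : ℤ) (d : SignType) :
    act (M.wordTapes w i) (onInput (scanned (M.wordTapes w i) M.input) d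
      (scanned (M.wordTapes w i))) = M.wordTapes w (i + d) := by
  apply act_onInput_wordTapes
  rw [scanned_wordTapes, Function.update_eq_self]

theorem act_write_wordTapes (w : List X) (x : X) :
    act (M.wordTapes w w.length) (onInput (M.encode x) 1 (scanned (M.wordTapes w w.length))) =
      M.wordTapes (w ++ [x]) (w ++ [x]).length := by
  rw [act_onInput_wordTapes w (w ++ [x]) _ _ _ (update_tapeOf _ _ _ _)]
  simp

theorem init_tapes (w : List X) : (M.init w).tapes = M.wordTapes w 0 := by
  refine Prod.ext ?_ ?_
  · funext τ i
    by_cases hτ : τ = M.input <;> simp [Config.tapes, init, wordTapes, tapeOf, hτ]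
  · funext τ
    simp [Config.tapes, init, wordTapes]

theorem step_state {c : M.Config} {q : M.State} (h : c.state = Sum.inl q) :
    (M.step c).state = (M.transition q (scanned c.tapes)).1 := by
  simp only [step, h]; rfl

theorem step_tapes {c : M.Config} {q : M.State} (h : c.state = Sum.inl q) :
    (M.step c).tapes = act c.tapes (M.transition q (scanned c.tapes)).2 := by
  simp only [step, h]; rfl

end Tapes

/-! ### Running one machine as a guard for another one -/

section Guard

variable (T : Transducer X Y) (M : TuringMachine Y) (K : TuringMachine X)

/-- The states of the machine `TuringMachine.guard`. -/
inductive GuardState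
  | scan (q : T.State) (l : {l : List Y // l.length ≤ T.bound})
  | rewindInput
  | rewindOutput
  | guard (s : M.State)
  | main (s : K.State)

theorem finite_guardState [Finite Y] : Finite (GuardState T M K) := by
  have := T.finite_state
  have := M.finite_state
  have := K.finite_state
  have : Finite {l : List Y // l.length ≤ T.bound} := (List.finite_length_le Y T.bound).to_subtype
  let e : (T.State × {l : List Y // l.length ≤ T.bound}) ⊕ Bool ⊕ M.State ⊕ K.State →
      GuardState T M K := Sum.elim (fun p => .scan p.1 p.2) (Sum.elim
        (fun b => if b then .rewindInput else .rewindOutput) (Sum.elim .guard .main))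
  refine Finite.of_surjective e ?_
  rintro (⟨q, l⟩ | _ | _ | s | s)
  · exact ⟨Sum.inl (q, l), rfl⟩
  · exact ⟨Sum.inr (Sum.inl true), rfl⟩
  · exact ⟨Sum.inr (Sum.inl false), rfl⟩
  · exact ⟨Sum.inr (Sum.inr (Sum.inl s)), rfl⟩
  · exact ⟨Sum.inr (Sum.inr (Sum.inr s)), rfl⟩

variable {T M K} in
/-- The state after the guard has passed to a given state: if it has accepted, the main machine
starts. -/
def guardNext : M.State ⊕ Bool → GuardState T M K ⊕ Bool
  | Sum.inl s => Sum.inl (.guard s)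
  | Sum.inr true => Sum.inl (.main K.start)
  | Sum.inr false => Sum.inr false

open Classical in
/-- The transitions of `TuringMachine.guard`, separately for the tapes of `K` and of `M`. -/
noncomputable def guardTransition (s : GuardState T M K) (k : K.Tape → K.Symbol)
    (m : M.Tape → M.Symbol) : (GuardState T M K ⊕ Bool) ×
      (K.Tape → K.Symbol × SignType) × (M.Tape → M.Symbol × SignType) :=
  match s with
  -- The list in the state buffers output still to be written, since a step writes only one symbol
  -- per tape.
  | .scan q ⟨y :: l, h⟩ =>
    (Sum.inl (.scan q ⟨l, (Nat.le_succ _).trans h⟩), idle k, onInput (M.encode y) 1 m)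
  | .scan q ⟨[], _⟩ =>
    if h : ∃ x, K.encode x = k K.input then
      (Sum.inl (.scan (T.next q h.choose) ⟨T.output q h.choose, T.length_output_le _ _⟩),
        onInput (k K.input) 1 k, idle m)
    else if T.accept q then
      -- End of input: both heads stand on the blank just after their words and step back onto the
      -- last letters, so that rewinding can stop at the next blank, in cell -1.
      (Sum.inl .rewindInput, onInput (k K.input) (-1) k, onInput (m M.input) (-1) m)
    else (Sum.inr false, idle k, idle m)
  | .rewindInput =>
    if k K.input = K.blank then (Sum.inl .rewindOutput, onInput (k K.input) 1 k, idle m)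
    else (Sum.inl .rewindInput, onInput (k K.input) (-1) k, idle m)
  | .rewindOutput =>
    if m M.input = M.blank then (Sum.inl (.guard M.start), idle k, onInput (m M.input) 1 m)
    else (Sum.inl .rewindOutput, idle k, onInput (m M.input) (-1) m)
  | .guard s => (guardNext (M.transition s m).1, idle k, (M.transition s m).2)
  | .main s => ((K.transition s k).1.map .main id, (K.transition s k).2, idle m)

/-- The machine that translates its input with `T`, runs `M` on the result and, if both `T` and `M`
accept, runs `K` on the input. -/
noncomputable def guard [Finite Y] : TuringMachine X where
  Tape := K.Tape ⊕ M.Tape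
  Symbol := K.Symbol × M.Symbol
  State := GuardState T M K
  finite_tape := by
    have := K.finite_tape
    have := M.finite_tape
    infer_instance
  finite_symbol := by
    have := K.finite_symbol
    have := M.finite_symbol
    infer_instance
  finite_state := finite_guardState T M K
  input := Sum.inl K.input
  blank := (K.blank, M.blank)
  encode x := (K.encode x, M.blank)
  encode_injective _ _ h := K.encode_injective (Prod.ext_iff.1 h).1
  encode_ne_blank x h := K.encode_ne_blank x (Prod.ext_iff.1 h).1
  start := .scan T.start ⟨[], Nat.zero_le _⟩
  transition s r :=
    let a := guardTransition T M K s (fun τ => (r (Sum.inl τ)).1) (fun τ => (r (Sum.inr τ)).2)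
    (a.1, Sum.elim (fun τ => (((a.2.1 τ).1, M.blank), (a.2.1 τ).2))
      (fun τ => ((K.blank, (a.2.2 τ).1), (a.2.2 τ).2)))

variable [Finite Y]

variable {T M K} in
/-- The configuration of `TuringMachine.guard` with given tapes of `K` and of `M`. -/
def glue (s : GuardState T M K ⊕ Bool) (k : K.Tapes) (m : M.Tapes) : (guard T M K).Config where
  state := s
  content := Sum.elim (fun τ i => (k.1 τ i, M.blank)) (fun τ i => (K.blank, m.1 τ i))
  head := Sum.elim k.2 m.2

variable {T M K}

/-- The second component stays blank on the tapes of `K`, and the first on those of `M`; so one step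
acts on the two halves independently. -/
theorem step_glue {s : GuardState T M K} {k : K.Tapes} {m : M.Tapes}
    {s' : GuardState T M K ⊕ Bool} {a : K.Tape → K.Symbol × SignType}
    {b : M.Tape → M.Symbol × SignType}
    (h : guardTransition T M K s (scanned k) (scanned m) = (s', a, b)) :
    (guard T M K).step (glue (Sum.inl s) k m) = glue s' (act k a) (act m b) := by
  have key : (guard T M K).transition s
      (fun τ => (glue (Sum.inl s) k m).content τ ((glue (Sum.inl s) k m).head τ)) =
      (s', Sum.elim (fun τ => (((a τ).1, M.blank), (a τ).2))
        (fun τ => ((K.blank, (b τ).1), (b τ).2))) := by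
    have : guardTransition T M K s
      (fun τ => ((glue (Sum.inl s) k m).content (Sum.inl τ)
        ((glue (Sum.inl s) k m).head (Sum.inl τ))).1)
      (fun τ => ((glue (Sum.inl s) k m).content (Sum.inr τ)
        ((glue (Sum.inl s) k m).head (Sum.inr τ))).2) = (s', a, b) := h
    simp only [guard, this]
  have hs : (glue (Sum.inl s) k m).state = Sum.inl s := rfl
  simp only [step, hs, key]
  refine Config.eq_of rfl ?_ ?_
  · funext τ i
    rcases τ with τ | τ
    · change Function.update (fun i => (k.1 τ i, M.blank)) (k.2 τ) ((a τ).1, M.blank) i =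
        (Function.update (k.1 τ) (k.2 τ) (a τ).1 i, M.blank)
      simp only [Function.update_apply]
      split_ifs <;> rfl
    · change Function.update (fun i => (K.blank, m.1 τ i)) (m.2 τ) (K.blank, (b τ).1) i =
        (K.blank, Function.update (m.1 τ) (m.2 τ) (b τ).1 i)
      simp only [Function.update_apply]
      split_ifs <;> rfl
  · funext τ
    rcases τ with τ | τ <;> rfl

theorem init_guard (w : List X) : (guard T M K).init w =
    glue (Sum.inl (.scan T.start ⟨[], Nat.zero_le _⟩)) (K.wordTapes w 0) (M.wordTapes [] 0) := by
  have h0 : ∀ i, tapeOf M.blank M.encode [] i = M.blank := fun i => by simp [tapeOf]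
  refine Config.eq_of rfl ?_ ?_
  · funext τ i
    rcases τ with τ | τ
    · by_cases hτ : τ = K.input
      · by_cases h : 0 ≤ i ∧ i.toNat < w.length <;>
          simp [init, glue, guard, wordTapes, hτ, tapeOf, h]
      · simp [init, glue, guard, wordTapes, hτ]
    · by_cases hτ : τ = M.input <;> simp [init, glue, guard, wordTapes, hτ, h0]
  · funext τ
    rcases τ with τ | τ <;> simp [init, glue, wordTapes]

theorem guard_emit (k : K.Tapes) (q : T.State) (l : List Y) (h : l.length ≤ T.bound) (o : List Y) :
    (guard T M K).step^[l.length] (glue (Sum.inl (.scan q ⟨l, h⟩)) k (M.wordTapes o o.length)) =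
      glue (Sum.inl (.scan q ⟨[], Nat.zero_le _⟩)) k (M.wordTapes (o ++ l) (o ++ l).length) := by
  induction l generalizing o with
  | nil => simp
  | cons y l ih =>
    rw [List.length_cons, Function.iterate_succ_apply, step_glue rfl, act_idle, act_write_wordTapes,
      ih ((Nat.le_succ _).trans h)]
    simp

theorem guard_read (u : List X) (x : X) (v : List X) (q : T.State) (m : M.Tapes) :
    (guard T M K).step (glue (Sum.inl (.scan q ⟨[], Nat.zero_le _⟩))
        (K.wordTapes (u ++ x :: v) u.length) m) =
      glue (Sum.inl (.scan (T.next q x) ⟨T.output q x, T.length_output_le _ _⟩))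
        (K.wordTapes (u ++ x :: v) (u ++ [x]).length) m := by
  have hs : scanned (K.wordTapes (u ++ x :: v) u.length) K.input = K.encode x := by
    rw [scanned_wordTapes, tapeOf_append_cons]
  have hx : ∃ x', K.encode x' = scanned (K.wordTapes (u ++ x :: v) u.length) K.input := ⟨x, hs.symm⟩
  have hc : hx.choose = x := K.encode_injective (hx.choose_spec.trans hs)
  have := step_glue (T := T) (M := M) (K := K) (s := .scan q ⟨[], Nat.zero_le _⟩)
    (k := K.wordTapes (u ++ x :: v) u.length) (m := m) (by rw [guardTransition, dif_pos hx])
  rw [this, act_idle, act_move_wordTapes]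
  simp [hc]

/-- Each input letter costs one step to read and each output letter one step to write; the induction
is on the unread part `v`. -/
theorem guard_scan (u v : List X) (q : T.State) (o : List Y) :
    (guard T M K).step^[v.length + (T.translate q v).length]
      (glue (Sum.inl (.scan q ⟨[], Nat.zero_le _⟩)) (K.wordTapes (u ++ v) u.length)
        (M.wordTapes o o.length)) =
      glue (Sum.inl (.scan (T.final q v) ⟨[], Nat.zero_le _⟩))
        (K.wordTapes (u ++ v) (u ++ v).length)
        (M.wordTapes (o ++ T.translate q v) (o ++ T.translate q v).length) := by
  induction v generalizing u q o with
  | nil => simp [Transducer.translate, Transducer.final]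
  | cons x v ih =>
    have e : (x :: v).length + (T.translate q (x :: v)).length =
        (v.length + (T.translate (T.next q x) v).length) + ((T.output q x).length + 1) := by
      simp [Transducer.translate]; ring
    have h := ih (u ++ [x]) (T.next q x) (o ++ T.output q x)
    rw [e, Function.iterate_add_apply, Function.iterate_succ_apply, guard_read, guard_emit]
    simp only [List.append_assoc, List.singleton_append] at h
    simpa [Transducer.translate, Transducer.final] using h

theorem guard_rewindInput (w : List X) (m : M.Tapes) (n : ℕ) (hn : n ≤ w.length) :
    (guard T M K).step^[n + 1] (glue (Sum.inl .rewindInput) (K.wordTapes w (n - 1)) m) =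
      glue (Sum.inl .rewindOutput) (K.wordTapes w 0) m := by
  induction n with
  | zero =>
    have h : scanned (K.wordTapes w ((0 : ℕ) - 1)) K.input = K.blank := by
      rw [scanned_wordTapes]; exact tapeOf_neg_one _ _ _
    have := step_glue (T := T) (M := M) (K := K) (s := .rewindInput)
      (k := K.wordTapes w ((0 : ℕ) - 1)) (m := m) (by rw [guardTransition, if_pos h])
    rw [zero_add, Function.iterate_one, this, act_idle, act_move_wordTapes]
    simp
  | succ n ih =>
    have e : (((n + 1 : ℕ) : ℤ) - 1) = (n : ℤ) := by simp
    have h : scanned (K.wordTapes w n) K.input ≠ K.blank := by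
      rw [scanned_wordTapes]
      exact tapeOf_natCast_ne _ _ K.encode_ne_blank (by omega)
    have := step_glue (T := T) (M := M) (K := K) (s := .rewindInput)
      (k := K.wordTapes w n) (m := m) (by rw [guardTransition, if_neg h])
    rw [Function.iterate_succ_apply, e, this, act_idle, act_move_wordTapes]
    simpa [sub_eq_add_neg] using ih (by omega)

theorem guard_rewindOutput (k : K.Tapes) (o : List Y) (n : ℕ) (hn : n ≤ o.length) :
    (guard T M K).step^[n + 1] (glue (Sum.inl .rewindOutput) k (M.wordTapes o (n - 1))) =
      glue (Sum.inl (.guard M.start)) k (M.wordTapes o 0) := by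
  induction n with
  | zero =>
    have h : scanned (M.wordTapes o ((0 : ℕ) - 1)) M.input = M.blank := by
      rw [scanned_wordTapes]; exact tapeOf_neg_one _ _ _
    have := step_glue (T := T) (M := M) (K := K) (s := .rewindOutput)
      (m := M.wordTapes o ((0 : ℕ) - 1)) (k := k) (by rw [guardTransition, if_pos h])
    rw [zero_add, Function.iterate_one, this, act_idle, act_move_wordTapes]
    simp
  | succ n ih =>
    have e : (((n + 1 : ℕ) : ℤ) - 1) = (n : ℤ) := by simp
    have h : scanned (M.wordTapes o n) M.input ≠ M.blank := by
      rw [scanned_wordTapes]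
      exact tapeOf_natCast_ne _ _ M.encode_ne_blank (by omega)
    have := step_glue (T := T) (M := M) (K := K) (s := .rewindOutput)
      (m := M.wordTapes o n) (k := k) (by rw [guardTransition, if_neg h])
    rw [Function.iterate_succ_apply, e, this, act_idle, act_move_wordTapes]
    simpa [sub_eq_add_neg] using ih (by omega)

/-- The simulation is faithful only up to the halting time of `M`: afterwards `M` stands still,
while the guarded machine may go on with `K`. -/
theorem guard_run_guard (k : K.Tapes) (o : List Y) (t : ℕ) (ht : t ≤ M.time o) :
    (guard T M K).step^[t] (glue (Sum.inl (.guard M.start)) k (M.wordTapes o 0)) =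
      glue (guardNext (M.run o t).state) k (M.run o t).tapes := by
  induction t with
  | zero => simp only [run, Function.iterate_zero, id, init_tapes]; rfl
  | succ t ih =>
    obtain ⟨q, hq⟩ := exists_state_of_lt_time (Nat.lt_of_succ_le ht)
    rw [Function.iterate_succ_apply', ih (by omega), hq]
    have hr : M.run o (t + 1) = M.step (M.run o t) := Function.iterate_succ_apply' _ _ _
    rw [hr, step_state hq, step_tapes hq]
    refine (step_glue rfl).trans ?_
    rw [act_idle]

theorem guard_run_main (w : List X) (m : M.Tapes) (t : ℕ) (ht : t ≤ K.time w) :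
    (guard T M K).step^[t] (glue (Sum.inl (.main K.start)) (K.wordTapes w 0) m) =
      glue ((K.run w t).state.map .main id) (K.run w t).tapes m := by
  induction t with
  | zero => simp only [run, Function.iterate_zero, id, init_tapes]; rfl
  | succ t ih =>
    obtain ⟨q, hq⟩ := exists_state_of_lt_time (Nat.lt_of_succ_le ht)
    rw [Function.iterate_succ_apply', ih (by omega), hq]
    have hr : K.run w (t + 1) = K.step (K.run w t) := Function.iterate_succ_apply' _ _ _
    rw [hr, step_state hq, step_tapes hq]
    refine (step_glue rfl).trans ?_
    rw [act_idle]

theorem guard_run_scan (w : List X) :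
    (guard T M K).run w (w.length + (T.translate T.start w).length) =
      glue (Sum.inl (.scan (T.final T.start w) ⟨[], Nat.zero_le _⟩)) (K.wordTapes w w.length)
        (M.wordTapes (T.translate T.start w) (T.translate T.start w).length) := by
  rw [run, init_guard]
  simpa using guard_scan [] w T.start []

theorem not_exists_encode_eq (w : List X) :
    ¬ ∃ x, K.encode x = scanned (K.wordTapes w w.length) K.input := by
  rintro ⟨x, hx⟩
  rw [scanned_wordTapes, tapeOf_length] at hx
  exact K.encode_ne_blank x hx

theorem guard_run_reject (w : List X) (h : ¬ T.accept (T.final T.start w)) :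
    ((guard T M K).run w (w.length + (T.translate T.start w).length + 1)).state =
      Sum.inr false := by
  have hr := guard_run_scan (T := T) (M := M) (K := K) w
  rw [run] at hr ⊢
  rw [Function.iterate_succ_apply', hr, step_glue (by
    rw [guardTransition, dif_neg (not_exists_encode_eq w), if_neg h])]
  rfl

theorem guard_run_accept (w : List X) (h : T.accept (T.final T.start w)) (t : ℕ)
    (ht : t ≤ M.time (T.translate T.start w)) :
    (guard T M K).run w (2 * (w.length + (T.translate T.start w).length) + 3 + t) =
      glue (guardNext (M.run (T.translate T.start w) t).state) (K.wordTapes w 0)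
        (M.run (T.translate T.start w) t).tapes := by
  have hr := guard_run_scan (T := T) (M := M) (K := K) w
  set o := T.translate T.start w
  -- From the right: scanning, one turning step, rewinding the input, rewinding the output, and `t`
  -- steps of `M`.
  have e : 2 * (w.length + o.length) + 3 + t =
      t + ((o.length + 1) + ((w.length + 1) + ((w.length + o.length) + 1))) := by ring
  rw [run] at hr ⊢
  rw [e, Function.iterate_add_apply _ t, Function.iterate_add_apply _ (o.length + 1),
    Function.iterate_add_apply _ (w.length + 1),
    Function.iterate_succ_apply' _ (w.length + o.length), hr, step_glue (by
      rw [guardTransition, dif_neg (not_exists_encode_eq w), if_pos h]),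
    act_move_wordTapes, act_move_wordTapes]
  have h1 := guard_rewindInput (T := T) (M := M) (K := K) w (M.wordTapes o (o.length - 1))
    w.length le_rfl
  have h2 := guard_rewindOutput (T := T) (M := M) (K := K) (K.wordTapes w 0) o o.length le_rfl
  simp only [SignType.coe_neg, SignType.coe_one, ← sub_eq_add_neg]
  rw [h1, h2, guard_run_guard _ _ _ ht]

open Classical in
/-- Correctness and running time of `TuringMachine.guard`. -/
theorem guard_halts {D : Language Y} {E : Language X} (hM : M.Decides D) (hK : K.Decides E)
    (w : List X) : ∃ t ≤ 2 * (w.length + (T.translate T.start w).length) + 3 +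
        M.time (T.translate T.start w) +
          (if T.accept (T.final T.start w) ∧ T.translate T.start w ∈ D then K.time w else 0),
      ∃ b : Bool, ((guard T M K).run w t).state = Sum.inr b ∧
        (b = true ↔ (T.accept (T.final T.start w) ∧ T.translate T.start w ∈ D) ∧ w ∈ E) := by
  by_cases ha : T.accept (T.final T.start w)
  · obtain ⟨b, hb, hbD⟩ := hM.run_time (T.translate T.start w)
    have hr := guard_run_accept (T := T) (M := M) (K := K) w ha _ le_rfl
    cases b with
    | false =>
      refine ⟨_, Nat.le_add_right _ _, false, ?_, ?_⟩
      · rw [hr, hb]; rfl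
      · simp_all
    | true =>
      obtain ⟨b', hb', hbE⟩ := hK.run_time w
      have hD : T.translate T.start w ∈ D := hbD.1 rfl
      rw [if_pos ⟨ha, hD⟩]
      refine ⟨_, le_rfl, b', ?_, ?_⟩
      -- The guard has left the tapes of `K` as they were at the start of its run on `w`.
      · rw [run] at hr ⊢
        rw [add_comm _ (K.time w), Function.iterate_add_apply, hr, hb]
        have := guard_run_main (T := T) (K := K) w (M.run (T.translate T.start w)
          (M.time (T.translate T.start w))).tapes _ le_rfl
        refine (congrArg Config.state this).trans ?_
        rw [hb']; rfl
      · simp [ha, hD, hbE]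
  · refine ⟨_, ?_, false, guard_run_reject w ha, by simp [ha]⟩
    omega

end Guard

/-- The machine that accepts every input. -/
def acceptAll (X : Type) [Finite X] : TuringMachine X where
  Tape := Unit
  Symbol := Option X
  State := Unit
  finite_tape := inferInstance
  finite_symbol := inferInstance
  finite_state := inferInstance
  input := ()
  blank := none
  encode := some
  encode_injective := Option.some_injective X
  encode_ne_blank := Option.some_ne_none
  start := ()
  transition _ r := (Sum.inr true, fun τ => (r τ, 0))

theorem run_acceptAll_one [Finite X] (w : List X) :
    ((acceptAll X).run w 1).state = Sum.inr true := rfl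

end TuringMachine

/-! ### Rewriting words into a quotient of a subgroup of finite index -/

section Rewriting

/-- The element represented by a letter. -/
def letterValue {G : Type*} [Group G] {A : Type} (π : A → G) (x : A × Bool) : G :=
  if x.2 then π x.1 else (π x.1)⁻¹

theorem wordValue_append {G : Type*} [Group G] {A : Type} (π : A → G) (u v : List (A × Bool)) :
    wordValue π (u ++ v) = wordValue π u * wordValue π v := by
  simp [wordValue]

theorem wordValue_cons {G : Type*} [Group G] {A : Type} (π : A → G) (x : A × Bool)
    (w : List (A × Bool)) :
    wordValue π (x :: w) = letterValue π x * wordValue π w := by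
  simp [wordValue, letterValue]

theorem wordValue_inverse {G : Type*} [Group G] {A : Type} (π : A → G) (u : List (A × Bool)) :
    wordValue π (u.reverse.map fun x => (x.1, !x.2)) = (wordValue π u)⁻¹ := by
  induction u with
  | nil => simp [wordValue]
  | cons x u ih =>
    rw [List.reverse_cons, List.map_append, wordValue_append, ih, wordValue_cons, mul_inv_rev]
    rcases x with ⟨a, _ | _⟩ <;> simp [wordValue, letterValue]

theorem exists_wordValue_eq {G : Type*} [Group G] {A : Type} {π : A → G}
    (hπ : Subgroup.closure (Set.range π) = ⊤) (g : G) : ∃ u, wordValue π u = g := by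
  have hg : g ∈ Subgroup.closure (Set.range π) := hπ ▸ Subgroup.mem_top g
  induction hg using Subgroup.closure_induction with
  | mem x hx =>
    obtain ⟨a, rfl⟩ := hx
    exact ⟨[(a, true)], by simp [wordValue]⟩
  | one => exact ⟨[], rfl⟩
  | mul x y _ _ hx hy =>
    obtain ⟨u, rfl⟩ := hx
    obtain ⟨v, rfl⟩ := hy
    exact ⟨u ++ v, wordValue_append π u v⟩
  | inv x _ hx =>
    obtain ⟨u, rfl⟩ := hx
    exact ⟨_, wordValue_inverse π u⟩

/-- Schreier rewriting: a transducer turns words into words over generators of a quotient of a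
subgroup of finite index, and accepts the words that represent elements of the subgroup. -/
theorem exists_transducer {G : Type*} [Group G] {A : Type} [Finite A] (π : A → G)
    {H : Subgroup G} [H.FiniteIndex] {Q : Type*} [Group Q] (φ : H →* Q) {B : Type} {ρ : B → Q}
    (hρ : Subgroup.closure (Set.range ρ) = ⊤) :
    ∃ T : Transducer (A × Bool) (B × Bool), ∀ w,
      (T.accept (T.final T.start w) ∧ T.translate T.start w ∈ wordProblem ρ) ↔
        wordValue π w ∈ φ.ker.map H.subtype := by
  -- The states of a transducer live in `Type`, so the cosets are replaced by a copy there.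
  obtain ⟨J, ⟨e⟩⟩ : ∃ J : Type, Nonempty (G ⧸ H ≃ J) :=
    ⟨Fin (Nat.card (G ⧸ H)), ⟨Finite.equivFin _⟩⟩
  have : Finite J := Finite.of_equiv _ e
  let rep : J → G := fun j => (e.symm j).out
  have mk_rep : ∀ j, (rep j : G ⧸ H) = e.symm j := fun j => Quotient.out_eq' _
  -- After the prefix `u` the state is the coset u⁻¹H. It is H exactly if u lies in H.
  let next : J → A × Bool → J := fun j x => e ((letterValue π x)⁻¹ • e.symm j)
  have mem : ∀ j x, (rep j)⁻¹ * letterValue π x * rep (next j x) ∈ H := by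
    intro j x
    have h : (rep (next j x) : G ⧸ H) = ((letterValue π x)⁻¹ * rep j : G) := by
      rw [mk_rep, ← smul_eq_mul, ← MulAction.Quotient.smul_coe, mk_rep]
      simp [next]
    have := QuotientGroup.eq.1 h.symm
    simpa using this
  choose out hout using fun j x => exists_wordValue_eq hρ (φ ⟨_, mem j x⟩)
  obtain ⟨L, hL⟩ : ∃ L, ∀ j x, (out j x).length ≤ L := by
    obtain ⟨L, hL⟩ := (Set.finite_range fun p : J × A × Bool => (out p.1 p.2).length).bddAbove
    exact ⟨L, fun j x => hL ⟨(j, x), rfl⟩⟩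
  let T : Transducer (A × Bool) (B × Bool) :=
    { State := J
      finite_state := inferInstance
      start := e ((1 : G) : G ⧸ H)
      next := next
      output := out
      bound := L
      length_output_le := hL
      accept := fun j => j = e ((1 : G) : G ⧸ H) }
  -- The Schreier factors telescope along the word.
  have key : ∀ (w : List (A × Bool)) (j : J),
      ∃ h : (rep j)⁻¹ * wordValue π w * rep (T.final j w) ∈ H,
      wordValue ρ (T.translate j w) = φ ⟨_, h⟩ := by
    intro w
    induction w with
    | nil =>
      intro j
      have e1 : (rep j)⁻¹ * wordValue π [] * rep (T.final j []) = 1 := by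
        simp [wordValue, Transducer.final]
      refine ⟨by rw [e1]; exact one_mem H, ?_⟩
      simp only [e1]
      exact (map_one φ).symm
    | cons x w ih =>
      intro j
      obtain ⟨h, hw⟩ := ih (next j x)
      have e1 : (rep j)⁻¹ * wordValue π (x :: w) * rep (T.final j (x :: w)) =
          ((rep j)⁻¹ * letterValue π x * rep (next j x)) *
            ((rep (next j x))⁻¹ * wordValue π w * rep (T.final (next j x) w)) := by
        rw [wordValue_cons]
        change (rep j)⁻¹ * (letterValue π x * _) * rep (T.final (next j x) w) = _
        group
      refine ⟨by rw [e1]; exact mul_mem (mem j x) h, ?_⟩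
      simp only [e1]
      change wordValue ρ (out j x ++ T.translate (next j x) w) = _
      rw [wordValue_append, hout, hw, ← map_mul]
      rfl
  refine ⟨T, fun w => ?_⟩
  obtain ⟨h, hw⟩ := key w T.start
  have hr : rep T.start ∈ H := by
    have := mk_rep T.start
    rw [show e.symm T.start = ((1 : G) : G ⧸ H) from e.symm_apply_apply _] at this
    simpa using QuotientGroup.eq.1 this.symm
  change (T.final T.start w = T.start ∧ wordValue ρ (T.translate T.start w) = 1) ↔ _
  rw [hw]
  constructor
  · rintro ⟨hf, h1⟩
    rw [Subgroup.mem_map]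
    -- The chosen representative of H need not be 1, so the rewritten element is a conjugate of the
    -- given one within H; this does not affect membership in the kernel.
    refine ⟨⟨rep T.start, hr⟩ * ⟨_, h⟩ * ⟨rep T.start, hr⟩⁻¹, ?_, ?_⟩
    · rw [MonoidHom.mem_ker, map_mul, map_mul, h1, mul_one, ← map_mul, mul_inv_cancel, map_one]
    · simp [hf, mul_assoc]
  · rintro ⟨k, hk, hkw⟩
    have hkw : (k : G) = wordValue π w := hkw
    have hf : T.final T.start w = T.start := by
      apply e.symm.injective
      rw [← mk_rep, ← mk_rep, eq_comm, QuotientGroup.eq]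
      have : rep (T.final T.start w) ∈ H := by
        rw [← hkw] at h
        exact (H.mul_mem_cancel_left (H.mul_mem (H.inv_mem hr) k.2)).1 h
      exact H.mul_mem (H.inv_mem hr) this
    refine ⟨hf, ?_⟩
    have : (⟨_, h⟩ : H) = ⟨rep T.start, hr⟩⁻¹ * k * ⟨rep T.start, hr⟩ := by
      apply Subtype.ext
      simp [hf, hkw]
    rw [this, map_mul, map_mul, MonoidHom.mem_ker.1 hk, mul_one, ← map_mul, inv_mul_cancel, map_one]

end Rewriting

/-! ### Isoperimetry of group actions -/

section Boundary

variable {G : Type*} [Group G] {V : Type*} [MulAction G V]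

open Classical in
/-- The number of points of `F` that `g` moves out of `F`. -/
noncomputable def boundaryCard (g : G) (F : Finset V) : ℕ := (F.filter fun v => g • v ∉ F).card

theorem boundaryCard_one (F : Finset V) : boundaryCard (1 : G) F = 0 := by
  simp [boundaryCard]

/-- A point that `g * h` moves out of `F` either leaves under `h`, or `h` takes it to a point of `F`
that leaves under `g`. -/
theorem boundaryCard_mul_le (g h : G) (F : Finset V) :
    boundaryCard (g * h) F ≤ boundaryCard g F + boundaryCard h F := by
  classical
  unfold boundaryCard
  rw [← Finset.card_image_of_injective (F.filter fun v => g • v ∉ F) (MulAction.injective h⁻¹)]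
  refine (Finset.card_le_card ?_).trans (Finset.card_union_le _ _)
  intro v hv
  rw [Finset.mem_filter, mul_smul] at hv
  by_cases hF : h • v ∈ F
  · exact Finset.mem_union_left _ (Finset.mem_image.2
      ⟨h • v, Finset.mem_filter.2 ⟨hF, hv.2⟩, inv_smul_smul _ _⟩)
  · exact Finset.mem_union_right _ (Finset.mem_filter.2 ⟨hv.1, hF⟩)

/-- The points of `F` that stay in `F` under `g` correspond, via `g`, to those that stay under
`g⁻¹`. -/
theorem boundaryCard_inv (g : G) (F : Finset V) : boundaryCard g⁻¹ F = boundaryCard g F := by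
  classical
  have key : ∀ g : G, boundaryCard g F + (F.filter fun v => g • v ∈ F).card = F.card := by
    intro g
    rw [boundaryCard, add_comm]
    exact Finset.card_filter_add_card_filter_not _
  have e : (F.filter fun v => g • v ∈ F).card = (F.filter fun v => g⁻¹ • v ∈ F).card := by
    refine Finset.card_bij' (fun v _ => g • v) (fun v _ => g⁻¹ • v) ?_ ?_ ?_ ?_ <;>
      simp +contextual
  have h1 := key g
  have h2 := key g⁻¹
  omega

/-- By subadditivity, `k` can be the length of a word for `g`; it does not depend on `F`. -/
theorem boundaryCard_le_of_closure {A : Type*} [Fintype A] (π : A → G)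
    (hπ : Subgroup.closure (Set.range π) = ⊤) (g : G) :
    ∃ k : ℕ, ∀ F : Finset V, boundaryCard g F ≤ k * ∑ a, boundaryCard (π a) F := by
  have hg : g ∈ Subgroup.closure (Set.range π) := hπ ▸ Subgroup.mem_top g
  induction hg using Subgroup.closure_induction with
  | mem x hx =>
    obtain ⟨a, rfl⟩ := hx
    refine ⟨1, fun F => ?_⟩
    rw [one_mul]
    exact Finset.single_le_sum (f := fun a => boundaryCard (π a) F) (fun _ _ => Nat.zero_le _)
      (Finset.mem_univ a)
  | one => exact ⟨0, fun F => by simp [boundaryCard_one]⟩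
  | mul x y _ _ hx hy =>
    obtain ⟨k, hk⟩ := hx
    obtain ⟨l, hl⟩ := hy
    refine ⟨k + l, fun F => (boundaryCard_mul_le x y F).trans ?_⟩
    rw [add_mul]
    exact add_le_add (hk F) (hl F)
  | inv x _ hx =>
    obtain ⟨k, hk⟩ := hx
    exact ⟨k, fun F => by rw [boundaryCard_inv]; exact hk F⟩

/-- The isoperimetric inequality for `S` acting on `V`. -/
def Isoperimetric {ι : Type*} [Fintype ι] (s : ι → G) (V : Type*) [MulAction G V] (ε : ℝ) : Prop :=
  ∀ F : Finset V, ε * F.card ≤ ∑ i, (boundaryCard (s i) F : ℝ)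

theorem Isoperimetric.of_closure {ι A : Type*} [Fintype ι] [Fintype A] {s : ι → G} {ε : ℝ}
    (hε : 0 < ε) (hs : Isoperimetric s V ε) (π : A → G)
    (hπ : Subgroup.closure (Set.range π) = ⊤) :
    ∃ δ : ℝ, 0 < δ ∧ Isoperimetric π V δ := by
  choose k hk using fun i => boundaryCard_le_of_closure (V := V) π hπ (s i)
  refine ⟨ε / (∑ i, (k i : ℝ) + 1), by positivity, fun F => ?_⟩
  rw [div_mul_eq_mul_div, div_le_iff₀ (by positivity)]
  calc ε * F.card ≤ ∑ i, (boundaryCard (s i) F : ℝ) := hs F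
    _ ≤ ∑ i, (k i : ℝ) * ∑ a, (boundaryCard (π a) F : ℝ) :=
      Finset.sum_le_sum fun i _ => by exact_mod_cast hk i F
    _ = (∑ a, (boundaryCard (π a) F : ℝ)) * ∑ i, (k i : ℝ) := by
      rw [← Finset.sum_mul, mul_comm]
    _ ≤ _ := by gcongr; linarith

end Boundary

theorem exists_isoperimetric_of_not_isAmenableGroup {G : Type*} [Group G]
    (h : ¬ IsAmenableGroup G) :
    ∃ (S : Finset G) (ε : ℝ), 0 < ε ∧ Isoperimetric (fun s : S => (s : G)) G ε := by
  classical
  unfold IsAmenableGroup at h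
  push Not at h
  obtain ⟨S, ε, hε, h⟩ := h
  refine ⟨S, ε, hε, fun F => ?_⟩
  rcases F.eq_empty_or_nonempty with rfl | hF
  · simpa using Finset.sum_nonneg fun _ _ => Nat.cast_nonneg _
  -- The Følner condition uses right multiplication, the action left multiplication; inversion
  -- exchanges them.
  obtain ⟨s, hs, hlt⟩ := h (F.image (·⁻¹)) (hF.image _)
  rw [Finset.card_image_of_injective _ inv_injective] at hlt
  refine hlt.le.trans ?_
  have e : ((F.image (·⁻¹)).filter fun x => x * s ∉ F.image (·⁻¹)).card =
      boundaryCard s F := by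
    rw [← boundaryCard_inv]
    have hi : ∀ v, v ∈ F.image (·⁻¹) ↔ v⁻¹ ∈ F := fun v => by
      simp [Finset.mem_image, inv_eq_iff_eq_inv]
    refine Finset.card_bij' (fun v _ => v⁻¹) (fun v _ => v⁻¹) ?_ ?_ ?_ ?_ <;>
      simp +contextual [hi]
  have := Finset.single_le_sum (f := fun s : S => (boundaryCard (s : G) F : ℝ))
    (fun _ _ => Nat.cast_nonneg _) (Finset.mem_univ (⟨s, hs⟩ : S))
  convert this using 2

/-- The kernel N lies in H, so a coset of N determines its coset of H; within that coset, the cosets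
of N are told apart by `φ`. -/
theorem mk_out_mul_eq_iff {G : Type*} [Group G] {H : Subgroup G} {Q : Type*} [Group Q]
    (φ : H →* Q) (q q' : G ⧸ H) (h h' : H) :
    ((q.out * h : G) : G ⧸ φ.ker.map H.subtype) = (q'.out * h' : G) ↔ q = q' ∧ φ h = φ h' := by
  rw [QuotientGroup.eq]
  constructor
  · rintro ⟨k, hk, e⟩
    have hq : q = q' := by
      rw [← q.out_eq', ← q'.out_eq', QuotientGroup.eq]
      have : (q.out)⁻¹ * q'.out = ((h * k * h'⁻¹ : H) : G) := by
        have e' : (k : G) = _ := e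
        push_cast
        rw [e']
        group
      rw [this]
      exact SetLike.coe_mem _
    subst hq
    refine ⟨rfl, ?_⟩
    have : k = h⁻¹ * h' := by
      apply Subtype.ext
      have e' : (k : G) = _ := e
      push_cast
      rw [e']
      group
    rw [this] at hk
    have hk : φ (h⁻¹ * h') = 1 := hk
    rwa [map_mul, map_inv, inv_mul_eq_one] at hk
  · rintro ⟨rfl, e⟩
    refine ⟨h⁻¹ * h', ?_, ?_⟩
    · change φ (h⁻¹ * h') = 1
      rw [map_mul, map_inv, inv_mul_eq_one, e]
    · simp only [Subgroup.subtype_apply]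
      push_cast
      group
theorem exists_eq_mk_out_mul {G : Type*} [Group G] {H : Subgroup G} {Q : Type*} [Group Q]
    (φ : H →* Q) {σ : Q → H} (hσ : ∀ x, φ (σ x) = x) (v : G ⧸ φ.ker.map H.subtype) :
    ∃ (q : G ⧸ H) (x : Q), v = (q.out * σ x : G) := by
  induction v using QuotientGroup.induction_on with
  | H g =>
    have hg : ((g : G ⧸ H).out)⁻¹ * g ∈ H := QuotientGroup.eq.1 (Quotient.out_eq' _)
    refine ⟨g, φ ⟨_, hg⟩, ?_⟩
    have : (g : G ⧸ φ.ker.map H.subtype) = ((g : G ⧸ H).out * (⟨_, hg⟩ : H) : G) := by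
      simp
    rw [this, mk_out_mul_eq_iff]
    exact ⟨rfl, (hσ _).symm⟩

/-- The left cosets of the kernel of a homomorphism `φ` from a subgroup `H` onto `Q` form a union of
copies of `Q`, indexed by the left cosets of `H`. -/
theorem exists_bijective_smul_eq {G : Type*} [Group G] {H : Subgroup G} {Q : Type*} [Group Q]
    {φ : H →* Q} (hφ : Function.Surjective φ) :
    ∃ (p : (G ⧸ H) × Q → G ⧸ φ.ker.map H.subtype) (t : G ⧸ H → Q → G), Function.Bijective p ∧
      ∀ q y x, t q y • p (q, x) = p (q, y * x) := by
  choose σ hσ using hφ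
  -- Conjugating by the representative of `q` makes `y` act as left multiplication on the copy `q`;
  -- nothing is claimed about the other copies.
  refine ⟨fun y => (y.1.out * σ y.2 : G), fun q y => q.out * σ y * (q.out)⁻¹, ⟨?_, ?_⟩, ?_⟩
  · rintro ⟨q, x⟩ ⟨q', x'⟩ h
    have := (mk_out_mul_eq_iff φ _ _ _ _).1 h
    rw [hσ, hσ] at this
    exact Prod.ext this.1 this.2
  · intro v
    obtain ⟨q, x, rfl⟩ := exists_eq_mk_out_mul φ hσ v
    exact ⟨(q, x), rfl⟩
  · intro q y x
    have : (q.out * σ y * (q.out)⁻¹) • ((q.out * σ x : G) : G ⧸ φ.ker.map H.subtype) =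
        ((q.out * (σ y * σ x : H) : G) : G ⧸ φ.ker.map H.subtype) := by
      change ((_ * _ : G) : G ⧸ φ.ker.map H.subtype) = _
      congr 1
      push_cast
      group
    change _ • _ = ((_ : G) : G ⧸ φ.ker.map H.subtype)
    rw [this, mk_out_mul_eq_iff, map_mul, hσ, hσ, hσ]
    exact ⟨rfl, rfl⟩

/-- Cut `F` into its slices along the copies of `Q`. A point that leaves its slice under `s i`
leaves `F` under the element realising `s i` on that copy; this element depends on the copy, whence
the index set `J × ι`. -/
theorem Isoperimetric.of_bijective {G : Type*} [Group G] {V : Type*} [MulAction G V]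
    {Q : Type*} [Group Q] {J : Type*} [Fintype J] {p : J × Q → V} (hp : Function.Bijective p)
    {t : J → Q → G} (ht : ∀ q y x, t q y • p (q, x) = p (q, y * x))
    {ι : Type*} [Fintype ι] {s : ι → Q} {ε : ℝ} (hs : Isoperimetric s Q ε) :
    Isoperimetric (fun y : J × ι => t y.1 (s y.2)) V ε := by
  classical
  intro F
  let F' : J → Finset Q := fun q =>
    F.preimage (fun x => p (q, x)) (fun x _ y _ h => (Prod.ext_iff.1 (hp.1 h)).2)
  have mem_F' : ∀ q x, x ∈ F' q ↔ p (q, x) ∈ F := fun q x => Finset.mem_preimage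
  have card_F : F.card = ∑ q, (F' q).card := by
    rw [← Finset.card_sigma]
    symm
    refine Finset.card_bij (fun y _ => p (y.1, y.2)) ?_ ?_ ?_
    · rintro ⟨q, x⟩ h
      exact (mem_F' q x).1 (Finset.mem_sigma.1 h).2
    · rintro ⟨q, x⟩ _ ⟨q', x'⟩ _ h
      obtain ⟨rfl, rfl⟩ := Prod.ext_iff.1 (hp.1 h)
      rfl
    · intro v hv
      obtain ⟨⟨q, x⟩, rfl⟩ := hp.2 v
      exact ⟨⟨q, x⟩, Finset.mem_sigma.2 ⟨Finset.mem_univ _, (mem_F' q x).2 hv⟩, rfl⟩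
  have hle : ∀ q i, boundaryCard (s i) (F' q) ≤ boundaryCard (t q (s i)) F := by
    intro q i
    refine Finset.card_le_card_of_injOn (fun x => p (q, x)) ?_
      (fun x _ y _ h => (Prod.ext_iff.1 (hp.1 h)).2)
    intro x hx
    have hx := Finset.mem_filter.1 hx
    refine Finset.mem_coe.2 (Finset.mem_filter.2 ⟨(mem_F' q x).1 hx.1, ?_⟩)
    rw [ht]
    exact fun h => hx.2 ((mem_F' q _).2 h)
  calc ε * F.card = ∑ q, ε * (F' q).card := by
        rw [card_F]; push_cast; rw [Finset.mul_sum]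
    _ ≤ ∑ q, ∑ i, (boundaryCard (s i) (F' q) : ℝ) := Finset.sum_le_sum fun q _ => hs (F' q)
    _ ≤ ∑ q, ∑ i, (boundaryCard (t q (s i)) F : ℝ) := by
        gcongr with q _ i _; exact_mod_cast hle q i
    _ = _ := (Fintype.sum_prod_type (fun y : J × ι => (boundaryCard (t y.1 (s y.2)) F : ℝ))).symm

/-! ### The spectral gap -/

section Spectral

variable {G : Type*} [Group G] {V : Type*} [MulAction G V] {ι : Type*} [Fintype ι]

/-- The co-area argument: `f` is a sum of multiples of indicators of its superlevel sets, each of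
which satisfies the isoperimetric inequality. The induction peels off the lowest layer, of height
`min f` over `F`. -/
theorem Isoperimetric.sum_le_of_pos {s : ι → G} {ε : ℝ} (hs : Isoperimetric s V ε) (F : Finset V)
    (f : V → ℝ) (hf : ∀ v ∈ F, 0 < f v) (hf' : ∀ v ∉ F, f v = 0) :
    ε * ∑ v ∈ F, f v ≤ ∑ i, ∑ v ∈ F, max (f v - f (s i • v)) 0 := by
  classical
  induction hn : F.card using Nat.strong_induction_on generalizing F f with
  | _ n ih =>
    subst hn
    rcases F.eq_empty_or_nonempty with rfl | hF
    · simp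
    obtain ⟨u, hu, hmin⟩ := F.exists_min_image f hF
    let F' := F.filter fun v => f u < f v
    let f' : V → ℝ := fun v => if v ∈ F then f v - f u else 0
    have hsub : F' ⊆ F := Finset.filter_subset _ _
    have hzero : ∀ v ∈ F, v ∉ F' → f' v = 0 := by
      intro v hv hv'
      have h1 : ¬ f u < f v := fun h => hv' (Finset.mem_filter.2 ⟨hv, h⟩)
      have h2 := hmin v hv
      simp only [f', if_pos hv]
      linarith
    have hnonneg : ∀ v, 0 ≤ f' v := by
      intro v
      by_cases hv : v ∈ F
      · simp only [f', if_pos hv]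
        linarith [hmin v hv]
      · simp [f', hv]
    have hcard : F'.card < F.card :=
      Finset.card_lt_card ⟨hsub, fun h => lt_irrefl _ (Finset.mem_filter.1 (h hu)).2⟩
    have key := ih _ hcard F' f' (fun v hv => by
        have := Finset.mem_filter.1 hv
        simp only [f', if_pos this.1]
        linarith [this.2])
      (fun v hv => by
        by_cases hvF : v ∈ F
        · exact hzero v hvF hv
        · simp [f', hvF]) rfl
    rw [Finset.sum_subset hsub hzero] at key
    have key' : ε * ∑ v ∈ F, f' v ≤ ∑ i, ∑ v ∈ F, max (f' v - f' (s i • v)) 0 := by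
      refine key.trans (Finset.sum_le_sum fun i _ => ?_)
      exact Finset.sum_le_sum_of_subset_of_nonneg hsub fun _ _ _ => le_max_right _ _
    have hsum : ∑ v ∈ F, f v = ∑ v ∈ F, f' v + f u * F.card := by
      rw [mul_comm, ← nsmul_eq_mul, ← Finset.sum_const, ← Finset.sum_add_distrib]
      refine Finset.sum_congr rfl fun v hv => ?_
      simp [f', hv]
    have hterm : ∀ i, ∑ v ∈ F, max (f v - f (s i • v)) 0 =
        ∑ v ∈ F, max (f' v - f' (s i • v)) 0 + f u * boundaryCard (s i) F := by
      intro i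
      rw [boundaryCard, Finset.card_filter]
      push_cast
      rw [Finset.mul_sum, ← Finset.sum_add_distrib]
      refine Finset.sum_congr rfl fun v hv => ?_
      by_cases h : s i • v ∈ F
      · simp [f', hv, h]
      -- At a point moved out of `F`, both functions vanish at the target, so the removed layer
      -- accounts for exactly `f u`.
      · have h1 := hmin v hv
        have h2 := hf u hu
        simp only [f', hv, h, hf' _ h, if_true, if_false, not_false_eq_true, sub_zero, mul_one]
        rw [max_eq_left (by linarith), max_eq_left (by linarith)]
        ring
    calc ε * ∑ v ∈ F, f v = ε * ∑ v ∈ F, f' v + f u * (ε * F.card) := by rw [hsum]; ring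
      _ ≤ ∑ i, ∑ v ∈ F, max (f' v - f' (s i • v)) 0 + f u * ∑ i, (boundaryCard (s i) F : ℝ) :=
        add_le_add key' (mul_le_mul_of_nonneg_left (hs F) (hf u hu).le)
      _ = ∑ i, ∑ v ∈ F, max (f v - f (s i • v)) 0 := by
        simp only [hterm, Finset.sum_add_distrib, Finset.mul_sum]

/-- The standard scalar product on finitely supported functions. -/
noncomputable def finsuppDot (V : Type*) : (V →₀ ℝ) →ₗ[ℝ] (V →₀ ℝ) →ₗ[ℝ] ℝ :=
  LinearMap.mk₂ ℝ (fun f g => f.sum fun v a => a * g v)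
    (fun f f' g => Finsupp.sum_add_index' (by simp) (by intros; ring))
    (fun c f g => by
      rw [Finsupp.sum_smul_index' (by simp), Finsupp.smul_sum]
      simp only [smul_eq_mul, mul_assoc])
    (fun f g g' => by simp [Finsupp.sum, mul_add, Finset.sum_add_distrib])
    (fun c f g => by
      simp only [Finsupp.sum, Finsupp.smul_apply, smul_eq_mul, Finset.mul_sum]
      exact Finset.sum_congr rfl fun _ _ => by ring)

theorem finsuppDot_eq_sum {f : V →₀ ℝ} (g : V →₀ ℝ) {F : Finset V} (h : f.support ⊆ F) :
    finsuppDot V f g = ∑ v ∈ F, f v * g v :=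
  Finsupp.sum_of_support_subset f h (fun v a => a * g v) (by simp)

theorem finsuppDot_comm (f g : V →₀ ℝ) : finsuppDot V f g = finsuppDot V g f := by
  classical
  rw [finsuppDot_eq_sum g (F := f.support ∪ g.support) Finset.subset_union_left,
    finsuppDot_eq_sum f (F := f.support ∪ g.support) Finset.subset_union_right]
  exact Finset.sum_congr rfl fun _ _ => mul_comm _ _

theorem sq_sum_le_finsuppDot (f : V →₀ ℝ) (F : Finset V) :
    ∑ v ∈ F, f v ^ 2 ≤ finsuppDot V f f := by
  classical
  rw [finsuppDot_eq_sum f (F := f.support ∪ F) Finset.subset_union_left]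
  simp only [← pow_two]
  exact Finset.sum_le_sum_of_subset_of_nonneg Finset.subset_union_right fun _ _ _ => sq_nonneg _

/-- The action of a group element on finitely supported functions. -/
noncomputable def translation (V : Type*) [MulAction G V] (g : G) : (V →₀ ℝ) →ₗ[ℝ] (V →₀ ℝ) :=
  (Finsupp.domLCongr (MulAction.toPerm g)).toLinearMap

theorem translation_apply (g : G) (f : V →₀ ℝ) (v : V) : translation V g f v = f (g⁻¹ • v) := rfl

theorem translation_single (g : G) (v : V) (a : ℝ) :
    translation V g (Finsupp.single v a) = Finsupp.single (g • v) a := by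
  simp [translation]

theorem finsuppDot_translation_left (g : G) (f h : V →₀ ℝ) :
    finsuppDot V (translation V g f) h = finsuppDot V f (translation V g⁻¹ h) := by
  change Finsupp.sum (Finsupp.equivMapDomain (MulAction.toPerm g) f) (fun v a => a * h v) = _
  rw [Finsupp.sum_equivMapDomain]
  change _ = Finsupp.sum f fun v a => a * (translation V g⁻¹ h) v
  simp [translation_apply]

/-- The sum of the translations by a family of group elements. -/
noncomputable def walkOperator (s : ι → G) (V : Type*) [MulAction G V] :
    (V →₀ ℝ) →ₗ[ℝ] (V →₀ ℝ) := ∑ i, translation V (s i)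

theorem finsuppDot_walkOperator (s : ι → G) (f h : V →₀ ℝ) :
    finsuppDot V (walkOperator s V f) h = ∑ i, finsuppDot V f (translation V (s i)⁻¹ h) := by
  simp only [walkOperator, LinearMap.sum_apply, map_sum, finsuppDot_translation_left]

/-- Indeed x² - y² ≤ 2x(x - y), followed by the weighted arithmetic-geometric mean inequality. -/
theorem max_sq_sub_sq_le {x y c : ℝ} (hc : 0 < c) :
    max (x ^ 2 - y ^ 2) 0 ≤ c * x ^ 2 + c⁻¹ * (x - y) ^ 2 := by
  have h0 : 0 ≤ c⁻¹ * (c * x - (x - y)) ^ 2 := by positivity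
  have h1 : c⁻¹ * (c * x - (x - y)) ^ 2 = c * x ^ 2 - 2 * x * (x - y) + c⁻¹ * (x - y) ^ 2 := by
    field_simp
    ring
  refine max_le ?_ (by positivity)
  nlinarith [sq_nonneg (x - y)]

/-- Cheeger's inequality: the co-area bound is applied to f², and the differences of squares are
estimated by the Dirichlet form. -/
theorem Isoperimetric.finsuppDot_walkOperator_le_of_nonneg {s : ι → G} {ε : ℝ} (hε : 0 < ε)
    (hs : Isoperimetric s V ε) (hι : 0 < Fintype.card ι) (f : V →₀ ℝ) (hf : ∀ v, 0 ≤ f v) :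
    finsuppDot V (walkOperator s V f) f ≤
      (Fintype.card ι - ε ^ 2 / (8 * Fintype.card ι)) * finsuppDot V f f := by
  set k : ℝ := (Fintype.card ι : ℝ)
  have hk : 0 < k := Nat.cast_pos.2 hι
  set F := f.support
  set N := finsuppDot V f f
  have hN : N = ∑ v ∈ F, f v ^ 2 := by
    simp only [N, finsuppDot_eq_sum f (le_refl f.support), pow_two, F]
  have h1 := hs.sum_le_of_pos F (fun v => f v ^ 2)
    (fun v hv => pow_pos ((hf v).lt_of_ne (Finsupp.mem_support_iff.1 hv).symm) 2)
    (fun v hv => by simp [Finsupp.notMem_support_iff.1 hv])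
  -- With this weight, the terms in f² add up to half of the left-hand side, ε/2 times the squared
  -- norm, and can be absorbed.
  have hc : 0 < ε / (2 * k) := by positivity
  have h2 : ∀ i, ∑ v ∈ F, max (f v ^ 2 - f (s i • v) ^ 2) 0 ≤
      ε / (2 * k) * N + (ε / (2 * k))⁻¹ * (2 * N - 2 * finsuppDot V f (translation V (s i)⁻¹ f)) := by
    intro i
    calc ∑ v ∈ F, max (f v ^ 2 - f (s i • v) ^ 2) 0
        ≤ ∑ v ∈ F, (ε / (2 * k) * f v ^ 2 + (ε / (2 * k))⁻¹ * (f v - f (s i • v)) ^ 2) :=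
          Finset.sum_le_sum fun v _ => max_sq_sub_sq_le hc
      _ = ε / (2 * k) * N + (ε / (2 * k))⁻¹ * ∑ v ∈ F, (f v - f (s i • v)) ^ 2 := by
          rw [Finset.sum_add_distrib, ← Finset.mul_sum, ← Finset.mul_sum, hN]
      _ ≤ _ := by
          gcongr
          have e : ∑ v ∈ F, (f v - f (s i • v)) ^ 2 = N + ∑ v ∈ F, f (s i • v) ^ 2 -
              2 * finsuppDot V f (translation V (s i)⁻¹ f) := by
            rw [finsuppDot_eq_sum _ (le_refl f.support), hN, Finset.mul_sum,
              ← Finset.sum_add_distrib, ← Finset.sum_sub_distrib]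
            refine Finset.sum_congr rfl fun v _ => ?_
            rw [translation_apply, inv_inv]
            ring
          have h3 : ∑ v ∈ F, f (s i • v) ^ 2 ≤ N := by
            refine le_trans (le_of_eq ?_)
              (sq_sum_le_finsuppDot f (F.map (MulAction.toPerm (s i)).toEmbedding))
            simp
          linarith
  have h3 : ε * N ≤ ∑ i, (ε / (2 * k) * N +
      (ε / (2 * k))⁻¹ * (2 * N - 2 * finsuppDot V f (translation V (s i)⁻¹ f))) := by
    refine le_trans ?_ (h1.trans (Finset.sum_le_sum fun i _ => h2 i))
    rw [hN]
  rw [Finset.sum_add_distrib, ← Finset.mul_sum, ← Finset.mul_sum, Finset.sum_sub_distrib,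
    ← Finset.mul_sum, ← Finset.mul_sum, ← finsuppDot_walkOperator, Finset.sum_const,
    Finset.card_univ, nsmul_eq_mul] at h3
  set B := finsuppDot V (walkOperator s V f) f
  change ε * N ≤ ε / (2 * k) * (k * N) + _ * (2 * (k * N) - _) at h3
  have e : ε / (2 * k) * (k * N) + (ε / (2 * k))⁻¹ * (2 * (k * N) - 2 * B) =
      ε / 2 * N + 4 * k / ε * (k * N - B) := by
    field_simp
    ring
  rw [e] at h3
  have h4 : ε / 2 * N ≤ 4 * k / ε * (k * N - B) := by linarith
  have h5 : ε / (4 * k) * (ε / 2 * N) ≤ ε / (4 * k) * (4 * k / ε * (k * N - B)) := by gcongr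
  have e1 : ε / (4 * k) * (4 * k / ε * (k * N - B)) = k * N - B := by field_simp
  have e2 : ε / (4 * k) * (ε / 2 * N) = ε ^ 2 / (8 * k) * N := by field_simp; ring
  rw [e1, e2] at h5
  linarith

/-- Reduces the bound on the numerical radius to non-negative functions; it thus controls the
negative end of the spectrum too. -/
theorem abs_finsuppDot_walkOperator_le (s : ι → G) (f : V →₀ ℝ) :
    |finsuppDot V (walkOperator s V f) f| ≤
      finsuppDot V (walkOperator s V (f.mapRange abs abs_zero)) (f.mapRange abs abs_zero) := by
  rw [finsuppDot_walkOperator, finsuppDot_walkOperator]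
  refine (Finset.abs_sum_le_sum_abs _ _).trans (Finset.sum_le_sum fun i _ => ?_)
  rw [finsuppDot_eq_sum _ (le_refl f.support), finsuppDot_eq_sum _ (Finsupp.support_mapRange)]
  refine (Finset.abs_sum_le_sum_abs _ _).trans (le_of_eq (Finset.sum_congr rfl fun v _ => ?_))
  simp [translation_apply, abs_mul]

theorem finsuppDot_mapRange_abs (f : V →₀ ℝ) :
    finsuppDot V (f.mapRange abs abs_zero) (f.mapRange abs abs_zero) = finsuppDot V f f := by
  rw [finsuppDot_eq_sum _ (le_refl f.support), finsuppDot_eq_sum _ (Finsupp.support_mapRange)]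
  simp

/-- The operator norm of a symmetric operator is bounded by its numerical radius. -/
theorem apply_map_map_le_of_abs_le {E : Type*} [AddCommGroup E] [Module ℝ E]
    (B : E →ₗ[ℝ] E →ₗ[ℝ] ℝ) (hB : ∀ f g, B f g = B g f) (P : E →ₗ[ℝ] E)
    (hP : ∀ f g, B (P f) g = B f (P g)) {r : ℝ} (hr : 0 < r)
    (h : ∀ f, |B (P f) f| ≤ r * B f f) (f : E) : B (P f) (P f) ≤ r ^ 2 * B f f := by
  -- Polarisation: the difference of the two quadratic forms is 4r‖Pf‖², and the parallelogram law
  -- evaluates the sum of the two bounds.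
  have h1 := (abs_le.1 (h (r • f + P f))).2
  have h2 := (abs_le.1 (h (r • f - P f))).1
  have e1 : B (P (P f)) f = B (P f) (P f) := hP _ _
  have e2 : B f (P f) = B (P f) f := hB _ _
  simp only [map_add, map_sub, map_smul, LinearMap.add_apply, LinearMap.sub_apply,
    LinearMap.smul_apply, smul_eq_mul, e1, e2] at h1 h2
  have : r * (4 * B (P f) (P f)) ≤ r * (2 * (r ^ 2 * B f f + B (P f) (P f))) := by linarith
  have := le_of_mul_le_mul_left this hr
  linarith

end Spectral

/-! ### Words representing elements of a subgroup -/

section Words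

variable {G : Type*} [Group G] {A : Type}

/-- The words of length `n`. -/
noncomputable def wordsOfLength (X : Type) [Finite X] (n : ℕ) : Finset (List X) :=
  (List.finite_length_eq X n).toFinset

theorem mem_wordsOfLength {X : Type} [Finite X] {n : ℕ} {w : List X} :
    w ∈ wordsOfLength X n ↔ w.length = n := by
  simp [wordsOfLength]

theorem sum_wordsOfLength_succ {X : Type} [Fintype X] {M : Type*} [AddCommMonoid M] (n : ℕ)
    (f : List X → M) :
    ∑ w ∈ wordsOfLength X (n + 1), f w = ∑ x, ∑ w ∈ wordsOfLength X n, f (x :: w) := by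
  rw [← Finset.sum_product']
  symm
  refine Finset.sum_bij (fun p _ => p.1 :: p.2) ?_ ?_ ?_ ?_
  · rintro ⟨x, w⟩ h
    simpa [mem_wordsOfLength] using h
  · rintro ⟨x, w⟩ _ ⟨x', w'⟩ _ h
    simpa using h
  · intro w hw
    rw [mem_wordsOfLength] at hw
    obtain ⟨x, w, rfl⟩ := List.exists_cons_of_length_eq_add_one hw
    exact ⟨(x, w), by simpa [mem_wordsOfLength] using hw, rfl⟩
  · intro _ _
    rfl

theorem card_wordsOfLength (X : Type) [Fintype X] (n : ℕ) :
    (wordsOfLength X n).card = Fintype.card X ^ n := by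
  induction n with
  | zero =>
    rw [pow_zero, Finset.card_eq_one]
    exact ⟨[], by ext w; simp [mem_wordsOfLength]⟩
  | succ n ih =>
    rw [Finset.card_eq_sum_ones, sum_wordsOfLength_succ]
    simp [ih, pow_succ, mul_comm]

variable {V : Type*} [MulAction G V]

theorem walkOperator_pow_single [Fintype A] (π : A → G) (v : V) (n : ℕ) :
    ((walkOperator (letterValue π) V) ^ n) (Finsupp.single v 1) =
      ∑ w ∈ wordsOfLength (A × Bool) n, Finsupp.single (wordValue π w • v) (1 : ℝ) := by
  induction n with
  | zero =>
    have : wordsOfLength (A × Bool) 0 = {[]} := by ext w; simp [mem_wordsOfLength]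
    simp [this, wordValue]
  | succ n ih =>
    rw [pow_succ', Module.End.mul_apply, ih, sum_wordsOfLength_succ]
    simp only [walkOperator, LinearMap.sum_apply, map_sum, translation_single, wordValue_cons,
      mul_smul]
    exact Finset.sum_comm

theorem finsuppDot_walkOperator_symm [Fintype A] (π : A → G) (f h : V →₀ ℝ) :
    finsuppDot V (walkOperator (letterValue π) V f) h =
      finsuppDot V f (walkOperator (letterValue π) V h) := by
  rw [finsuppDot_walkOperator]
  simp only [walkOperator, LinearMap.sum_apply, map_sum]
  refine Fintype.sum_equiv ((Equiv.refl A).prodCongr Equiv.boolNot) _ _ ?_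
  rintro ⟨a, b⟩
  cases b <;> simp [letterValue]

theorem Isoperimetric.letterValue [Fintype A] {π : A → G} {ε : ℝ} (h : Isoperimetric π V ε) :
    Isoperimetric (letterValue π) V ε := by
  intro F
  refine (h F).trans ?_
  rw [Fintype.sum_prod_type]
  refine Finset.sum_le_sum fun a _ => ?_
  simp [_root_.letterValue]

open Classical in
-- The number of words of length `n` fixing `v` is the coefficient at `v` of the n-th power of the
-- walk operator applied to the indicator of `v`; it is at most the norm of that vector, hence at
-- most (k - δ)ⁿ.
theorem Isoperimetric.exists_card_stabilizing_le [Fintype A] {π : A → G} {ε : ℝ} (hε : 0 < ε)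
    (h : Isoperimetric π V ε) (v : V) : ∃ r : ℝ, 0 < r ∧ r < 1 ∧ ∀ n,
      (((wordsOfLength (A × Bool) n).filter fun w => wordValue π w • v = v).card : ℝ) ≤
        (r * Fintype.card (A × Bool)) ^ n := by
  have h := h.letterValue
  set k : ℝ := (Fintype.card (A × Bool) : ℝ)
  have hb : ∀ g : G, (boundaryCard g ({v} : Finset V) : ℝ) ≤ 1 := fun g => by
    exact_mod_cast Finset.card_filter_le _ _
  -- Testing the inequality on a single point gives ε ≤ k, whence k > 0 and δ < k.
  have hεk : ε ≤ k := by
    have := (h {v}).trans (Finset.sum_le_sum fun i _ => hb _)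
    simpa [k] using this
  have hk : 0 < k := hε.trans_le hεk
  set δ := ε ^ 2 / (8 * k)
  have hδ : 0 < δ := by positivity
  have hδk : δ < k := by
    rw [div_lt_iff₀ (by positivity)]
    nlinarith
  set P := walkOperator (_root_.letterValue π) V
  have hP : ∀ f, |finsuppDot V (P f) f| ≤ (k - δ) * finsuppDot V f f := fun f =>
    (abs_finsuppDot_walkOperator_le _ f).trans (by
      have := h.finsuppDot_walkOperator_le_of_nonneg hε (Nat.cast_pos.1 hk)
        (f.mapRange abs abs_zero) (fun v => by simp)
      rwa [finsuppDot_mapRange_abs] at this)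
  have hP2 := apply_map_map_le_of_abs_le (finsuppDot V) finsuppDot_comm P
    (finsuppDot_walkOperator_symm π) (sub_pos.2 hδk) hP
  have hPn : ∀ n, finsuppDot V ((P ^ n) (Finsupp.single v 1)) ((P ^ n) (Finsupp.single v 1)) ≤
      ((k - δ) ^ n) ^ 2 := by
    intro n
    induction n with
    | zero =>
      rw [pow_zero, Module.End.one_apply, finsuppDot_eq_sum (F := {v}) _ Finsupp.support_single_subset]
      simp
    | succ n ih =>
      rw [pow_succ', Module.End.mul_apply]
      refine (hP2 _).trans ?_
      rw [pow_succ (k - δ) n, mul_pow, mul_comm]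
      gcongr
  refine ⟨(k - δ) / k, div_pos (sub_pos.2 hδk) hk, by rw [div_lt_one hk]; linarith, fun n => ?_⟩
  rw [div_mul_cancel₀ _ hk.ne']
  refine le_of_sq_le_sq ?_ (pow_nonneg (sub_pos.2 hδk).le n)
  refine le_trans (le_of_eq ?_)
    ((sq_sum_le_finsuppDot ((P ^ n) (Finsupp.single v 1)) {v}).trans (hPn n))
  rw [Finset.sum_singleton, walkOperator_pow_single]
  simp [Finsupp.finsetSum_apply, Finsupp.single_apply]

end Words

open Classical in
/-- If a subgroup `H` of finite index has a non-amenable quotient, then the words that represent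
elements of the kernel form an exponentially small proportion of all words. -/
theorem exists_card_mem_ker_le {G : Type*} [Group G] {H : Subgroup G} [H.FiniteIndex]
    {Q : Type*} [Group Q] {φ : H →* Q} (hφ : Function.Surjective φ) (hQ : ¬ IsAmenableGroup Q)
    {A : Type} [Fintype A] {π : A → G} (hπ : Subgroup.closure (Set.range π) = ⊤) :
    ∃ r : ℝ, 0 < r ∧ r < 1 ∧ ∀ n, (((wordsOfLength (A × Bool) n).filter fun w =>
      wordValue π w ∈ φ.ker.map H.subtype).card : ℝ) ≤ (r * Fintype.card (A × Bool)) ^ n := by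
  obtain ⟨S, ε, hε, hS⟩ := exists_isoperimetric_of_not_isAmenableGroup hQ
  obtain ⟨p, t, hp, ht⟩ := exists_bijective_smul_eq hφ
  have := Fintype.ofFinite (G ⧸ H)
  obtain ⟨δ, hδ, h⟩ := (hS.of_bijective hp ht).of_closure hε π hπ
  obtain ⟨r, hr, hr1, hn⟩ := h.exists_card_stabilizing_le hδ
    ((1 : G) : G ⧸ φ.ker.map H.subtype)
  refine ⟨r, hr, hr1, fun n => ?_⟩
  -- The stabiliser of the base coset is the kernel itself.
  convert hn n using 5 with w
  rw [MulAction.Quotient.smul_coe, smul_eq_mul, mul_one, eq_comm, QuotientGroup.eq]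
  simp

/-! ### Average-case complexity -/

theorem tsum_eq_tsum_wordsOfLength {X : Type} [Finite X] (g : List X → ℝ≥0∞) :
    ∑' w, g w = ∑' n, ∑ w ∈ wordsOfLength X n, g w := by
  classical
  have h1 : ∀ w : List X, g w = ∑' n, if n = w.length then g w else 0 := fun w => by
    rw [tsum_ite_eq]
  have h2 : ∀ n, ∑ w ∈ wordsOfLength X n, g w =
      ∑' w : List X, if n = w.length then g w else 0 := by
    intro n
    rw [tsum_eq_sum (s := wordsOfLength X n)]
    · exact Finset.sum_congr rfl fun w hw => by rw [if_pos (mem_wordsOfLength.1 hw).symm]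
    · exact fun w hw => if_neg fun h => hw (mem_wordsOfLength.2 h.symm)
  simp only [h2]
  rw [ENNReal.tsum_comm]
  exact tsum_congr h1

/-- If the mean of `T` over the words of each length `n` is at most `C f(n)`, then the average of
`T / f` is at most `C` for all length-invariant measures. -/
theorem tsum_div_mul_le_of_sum_le {X : Type} [Finite X] (T : List X → ℕ) (f : ℕ → ℕ)
    (C : ℝ≥0)
    (h : ∀ n, ((∑ w ∈ wordsOfLength X n, T w : ℕ) : ℝ≥0) ≤ C * f n * (wordsOfLength X n).card)
    {μ : PMF (List X)} (hμ : LengthInvariant μ) :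
    ∑' w : List X, (T w : ℝ≥0∞) / (f w.length : ℝ≥0∞) * μ w ≤ (C : ℝ≥0∞) := by
  have key : ∀ n, ∑ w ∈ wordsOfLength X n, (T w : ℝ≥0∞) / (f w.length : ℝ≥0∞) * μ w ≤
      C * ∑ w ∈ wordsOfLength X n, μ w := by
    intro n
    rcases (wordsOfLength X n).eq_empty_or_nonempty with he | ⟨w₀, h₀⟩
    · simp [he]
    have hp : ∀ w ∈ wordsOfLength X n, μ w = μ w₀ := fun w hw =>
      hμ w w₀ ((mem_wordsOfLength.1 hw).trans (mem_wordsOfLength.1 h₀).symm)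
    rw [Finset.sum_congr rfl hp, Finset.sum_congr rfl fun w hw => by
        rw [hp w hw, mem_wordsOfLength.1 hw, div_eq_mul_inv],
      ← Finset.sum_mul, ← Finset.sum_mul, Finset.sum_const, nsmul_eq_mul, ← mul_assoc]
    refine mul_le_mul' ?_ le_rfl
    rw [← div_eq_mul_inv]
    refine ENNReal.div_le_of_le_mul ?_
    have h := ENNReal.coe_le_coe.2 (h n)
    push_cast at h
    rw [mul_right_comm]
    exact h
  rw [tsum_eq_tsum_wordsOfLength]
  calc _ ≤ ∑' n, C * ∑ w ∈ wordsOfLength X n, μ w := ENNReal.tsum_le_tsum key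
    _ = C := by rw [ENNReal.tsum_mul_left, ← tsum_eq_tsum_wordsOfLength, μ.tsum_coe, mul_one]

theorem Subexponential.exists_le_mul_pow {f : ℕ → ℕ} (hf : Subexponential f) {s : ℝ} (hs : 1 < s) :
    ∃ R : ℝ≥0, ∀ n, (f n : ℝ) ≤ R * s ^ n := by
  obtain ⟨R, hR⟩ := (hf s hs).bddAbove_range
  refine ⟨R.toNNReal, fun n => ?_⟩
  have h : (f n : ℝ) / s ^ n ≤ R := hR ⟨n, rfl⟩
  rw [div_le_iff₀ (by positivity)] at h
  refine h.trans ?_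
  gcongr
  exact Real.le_coe_toNNReal R

/-- A subexponential function of a linearly bounded argument, weighted by a decaying exponential, is
bounded. -/
theorem Subexponential.exists_pow_mul_le {f : ℕ → ℕ} (hf : Subexponential f) {r : ℝ} (hr : 0 < r)
    (hr1 : r < 1) (L : ℕ) : ∃ R : ℝ≥0, ∀ n i, i ≤ L * n → r ^ n * (f i : ℝ) ≤ R := by
  have h1 : 1 < r⁻¹ := (one_lt_inv₀ hr).2 hr1
  -- Chosen so that sⁱ ≤ r⁻ⁿ whenever i ≤ Ln; the root of order L + 1 also covers L = 0.
  set s : ℝ := r⁻¹ ^ (((L + 1 : ℕ) : ℝ)⁻¹)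
  have hs : 1 < s := Real.one_lt_rpow h1 (by positivity)
  have hsL : s ^ (L + 1) = r⁻¹ := Real.rpow_inv_natCast_pow (by positivity) (Nat.succ_ne_zero L)
  obtain ⟨R, hR⟩ := hf.exists_le_mul_pow hs
  refine ⟨R, fun n i hi => ?_⟩
  have h2 : s ^ i ≤ r⁻¹ ^ n := by
    rw [← hsL, ← pow_mul]
    exact pow_le_pow_right₀ hs.le (by nlinarith)
  calc r ^ n * (f i : ℝ) ≤ r ^ n * (R * r⁻¹ ^ n) := by
        gcongr
        exact (hR i).trans (by gcongr)
    _ = R := by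
        rw [inv_pow]
        field_simp

/-! ### Solving the word problem -/

namespace TuringMachine

variable {X Y : Type} [Finite Y] {T : Transducer X Y} {M : TuringMachine Y} {K : TuringMachine X}

theorem guard_decides {D : Language Y} {E : Language X} (hM : M.Decides D) (hK : K.Decides E) :
    (guard T M K).Decides
      {w : List X | (T.accept (T.final T.start w) ∧ T.translate T.start w ∈ D) ∧ w ∈ E} := by
  intro w
  obtain ⟨t, -, b, hb⟩ := guard_halts (T := T) hM hK w
  exact ⟨t, b, hb⟩

open Classical in
theorem guard_time_le {D : Language Y} {E : Language X} (hM : M.Decides D) (hK : K.Decides E)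
    (w : List X) : (guard T M K).time w ≤ (2 * T.bound + 3) * (w.length + 1) +
        M.time (T.translate T.start w) +
          (if T.accept (T.final T.start w) ∧ T.translate T.start w ∈ D then K.time w else 0) := by
  obtain ⟨t, ht, b, hb, -⟩ := guard_halts (T := T) hM hK w
  refine (time_le hb).trans (ht.trans ?_)
  have := T.length_translate_le w T.start
  gcongr
  nlinarith

end TuringMachine

/-- A machine for the word problem with respect to one finite generating set yields a machine for
any other finite set of letters; the time bound is applied to an input that is longer by a constant
factor. -/
theorem exists_decides_wordProblem {G : Type*} [Group G] {A B : Type} [Finite A] [Finite B]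
    (π : A → G) {ρ : B → G} (hρ : Subgroup.closure (Set.range ρ) = ⊤) {f : ℕ → ℕ}
    {M : TuringMachine (B × Bool)} (hM : M.DecidesInTime (wordProblem ρ) f) :
    ∃ (K : TuringMachine (A × Bool)) (L : ℕ), K.Decides (wordProblem π) ∧
      ∀ w, ∃ i ≤ L * w.length, K.time w ≤ (2 * L + 4) * (w.length + 1) + f i := by
  -- For H = G and the identity quotient, rewriting is a mere change of generators; with a main
  -- machine that accepts everything, the guard alone decides.
  obtain ⟨T, hT⟩ := exists_transducer π (H := ⊤) (Subgroup.topEquiv (G := G)).toMonoidHom hρ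
  have hK : (TuringMachine.acceptAll (A × Bool)).Decides Set.univ := fun w =>
    ⟨1, true, TuringMachine.run_acceptAll_one w, iff_of_true rfl trivial⟩
  refine ⟨TuringMachine.guard T M (.acceptAll _), T.bound, ?_, fun w => ?_⟩
  · suffices wordProblem π = {w : List (A × Bool) | (T.accept (T.final T.start w) ∧
        T.translate T.start w ∈ wordProblem ρ) ∧ w ∈ Set.univ} by
      rw [this]
      exact TuringMachine.guard_decides hM.1 hK
    ext w
    change wordValue π w = 1 ↔ (T.accept (T.final T.start w) ∧
      T.translate T.start w ∈ wordProblem ρ) ∧ w ∈ Set.univ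
    rw [hT]
    simp only [Set.mem_univ, and_true]
    constructor
    · intro h
      rw [h]
      exact one_mem _
    · rintro ⟨k, hk, h⟩
      have hk : (k : G) = 1 := hk
      rw [← h, ← hk]
      rfl
  -- As `f` need not be monotone, it is evaluated at the actual length of the translated word.
  · refine ⟨_, T.length_translate_le w T.start, ?_⟩
    refine (TuringMachine.guard_time_le (T := T) hM.1 hK w).trans ?_
    have h1 := hM.2 (T.translate T.start w)
    have h2 := TuringMachine.time_le (TuringMachine.run_acceptAll_one w)
    split_ifs <;> nlinarith

theorem theoremA {G : Type*} [Group G] [Group.IsFinitelyPresented G]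
    (hG : WordProblemIn G SubExp)
    (H : Subgroup G) [H.FiniteIndex]
    {G₁ : Type*} [Group G₁] (φ : H →* G₁) (hφ : Function.Surjective φ)
    (hG₁ : ¬ IsAmenableGroup G₁)
    (𝒞 : TimeClass) (h𝒞 : ∀ X : Type, 𝒞.languages X ⊆ SubExp X)
    (hWP : WordProblemIn G₁ 𝒞.languages)
    (A : Type) [Finite A] (π : A → G) (hπ : Subgroup.closure (Set.range π) = ⊤) :
    SolvableOnAverageIn (wordProblem π) 𝒞 {μ : PMF (List (A × Bool)) | LengthInvariant μ} := by
  classical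
  have := Fintype.ofFinite A
  obtain ⟨B₀, _, ρ₀, hρ₀, f₀, hf₀, M₀, hM₀⟩ := hG
  obtain ⟨B₁, _, ρ₁, hρ₁, f₁, hf₁, M₁, hM₁⟩ := hWP
  obtain ⟨K, L, hK, hKt⟩ := exists_decides_wordProblem π hρ₀ hM₀
  obtain ⟨T, hT⟩ := exists_transducer π φ hρ₁
  obtain ⟨r, hr, hr1, hcard⟩ := exists_card_mem_ker_le hφ hG₁ hπ
  obtain ⟨R, hR⟩ := hf₀.exists_pow_mul_le hr hr1 L
  have hmono := (𝒞.proper f₁ hf₁).1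
  -- One more than the sum of the two linear coefficients in `hle`: the linear terms use c - 1
  -- copies of `f₁ (c * n + c)`, and the run of `M₁` uses the last one.
  set c := 2 * T.bound + 2 * L + 8
  set f : ℕ → ℕ := fun n => c * f₁ (c * n + c) + c
  have hle : ∀ n, (2 * T.bound + 3) * (n + 1) + f₁ (T.bound * n) + (2 * L + 4) * (n + 1) ≤ f n := by
    intro n
    have h1 : f₁ (T.bound * n) ≤ f₁ (c * n + c) := by
      refine hmono (le_trans (Nat.mul_le_mul_right n ?_) (Nat.le_add_right _ _))
      simp only [c]
      omega
    have h2 : n + 1 ≤ f₁ (c * n + c) := by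
      refine le_trans ?_ (𝒞.le_bound f₁ hf₁ _)
      have : 1 ≤ c := by simp only [c]; omega
      nlinarith
    have h3 : (c - 1) * (n + 1) ≤ (c - 1) * f₁ (c * n + c) := Nat.mul_le_mul_left _ h2
    have h4 : c = (c - 1) + 1 := by simp only [c]; omega
    have h5 : c - 1 = (2 * T.bound + 3) + (2 * L + 4) := by simp only [c]; omega
    calc _ = (c - 1) * (n + 1) + f₁ (T.bound * n) := by rw [h5]; ring
      _ ≤ (c - 1) * f₁ (c * n + c) + f₁ (c * n + c) := add_le_add h3 h1
      _ = c * f₁ (c * n + c) := by conv_rhs => rw [h4, add_mul, one_mul, ← h4]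
      _ ≤ f n := Nat.le_add_right _ _
  have htime : ∀ w : List (A × Bool), ∃ i ≤ L * w.length, (TuringMachine.guard T M₁ K).time w ≤
      f w.length + if wordValue π w ∈ φ.ker.map H.subtype then f₀ i else 0 := by
    intro w
    obtain ⟨i, hi, hiK⟩ := hKt w
    refine ⟨i, hi, (TuringMachine.guard_time_le (T := T) hM₁.1 hK w).trans ?_⟩
    have h1 := (hM₁.2 (T.translate T.start w)).trans (hmono (T.length_translate_le w T.start))
    have h2 := hle w.length
    simp only [hT]
    split_ifs <;> omega
  have hpos : ∀ n, 0 < f n := fun n => by simp only [f, c]; omega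
  refine ⟨TuringMachine.guard T M₁ K, f, 𝒞.rescale f₁ hf₁ c (by simp only [c]; omega), ?_, ?_, hpos,
    1 + R, fun μ hμ => ?_⟩
  -- The guard loses nothing, because 1 lies in the kernel.
  · suffices wordProblem π = {w : List (A × Bool) | (T.accept (T.final T.start w) ∧
        T.translate T.start w ∈ wordProblem ρ₁) ∧ w ∈ wordProblem π} by
      rw [this]
      exact TuringMachine.guard_decides hM₁.1 hK
    ext w
    change wordValue π w = 1 ↔ (T.accept (T.final T.start w) ∧
      T.translate T.start w ∈ wordProblem ρ₁) ∧ wordValue π w = 1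
    rw [hT, and_comm, iff_self_and]
    intro h
    rw [h]
    exact one_mem _
  · intro m n hmn
    simp only [f]
    gcongr
    exact hmono (by gcongr)
  · refine tsum_div_mul_le_of_sum_le _ f _ (fun n => ?_) hμ
    choose i hi ht using htime
    have key : ((∑ w ∈ wordsOfLength (A × Bool) n, (TuringMachine.guard T M₁ K).time w : ℕ) : ℝ) ≤
        (1 + R) * f n * (wordsOfLength (A × Bool) n).card := by
      set W := wordsOfLength (A × Bool) n
      set N := W.filter fun w => wordValue π w ∈ φ.ker.map H.subtype
      have hW : (W.card : ℝ) = (Fintype.card (A × Bool) : ℝ) ^ n := by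
        exact_mod_cast card_wordsOfLength (A × Bool) n
      have hN : (N.card : ℝ) ≤ r ^ n * W.card := by
        rw [hW, ← mul_pow]
        exact hcard n
      have hf1 : (1 : ℝ) ≤ f n := by exact_mod_cast hpos n
      -- The slow runs cost at most R / rⁿ each, and at most a fraction rⁿ of the words need them.
      have hb : ∀ w ∈ W, (f₀ (i w) : ℝ) ≤ R / r ^ n := by
        intro w hw
        rw [le_div_iff₀' (by positivity)]
        exact hR n (i w) (by simpa [mem_wordsOfLength.1 hw] using hi w)
      push_cast
      calc ∑ w ∈ W, ((TuringMachine.guard T M₁ K).time w : ℝ)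
          ≤ ∑ w ∈ W, ((f n : ℝ) +
              if wordValue π w ∈ φ.ker.map H.subtype then R / r ^ n else 0) := by
            refine Finset.sum_le_sum fun w hw => ?_
            have h1 : ((TuringMachine.guard T M₁ K).time w : ℝ) ≤ (f w.length : ℝ) +
                if wordValue π w ∈ φ.ker.map H.subtype then (f₀ (i w) : ℝ) else 0 := by
              exact_mod_cast ht w
            rw [mem_wordsOfLength.1 hw] at h1
            refine h1.trans (add_le_add le_rfl ?_)
            split_ifs
            · exact hb w hw
            · exact le_rfl
        _ = W.card * f n + N.card * (R / r ^ n) := by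
            rw [Finset.sum_add_distrib, Finset.sum_const, nsmul_eq_mul, ← Finset.sum_filter,
              Finset.sum_const, nsmul_eq_mul]
        _ ≤ W.card * f n + r ^ n * W.card * (R / r ^ n) := by gcongr
        _ = W.card * f n + W.card * R := by field_simp
        _ ≤ W.card * f n + W.card * R * f n := by
            exact add_le_add le_rfl (le_mul_of_one_le_right (by positivity) hf1)
        _ = _ := by ring
    exact_mod_cast key
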